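/- **Proposition 3.3.** Let $N\ge 2$, $p>1$, $s_1,s_p\in(0,1)$, and let $\Omega\subset\mathbb R^N$ be a bounded domain. For $S\subset\mathbb R^N$, $\gamma\in(0,1)$, $q\ge1$, let $W^{\gamma,q}(S)$ be the set of $w\in L^q(S)$ with $\int_S\int_S\frac{|w(x)-w(y)|^q}{|x-y|^{N+\gamma q}}\,dx\,dy<\infty$, and let $W^{\gamma,q}_{\rm loc}(\Omega)$ be the set of functions belonging to $W^{\gamma,q}(U)$ for every open $U\subset\subset\Omega$. Let $L^{p-1}_{s_pp}(\mathbb R^N)$ be the set of $w\in L^{p-1}_{\rm loc}(\mathbb R^N)$ with $\int_{\mathbb R^N}\frac{|w(x)|^{p-1}}{(1+|x|)^{N+s_pp}}\,dx<\infty$. For such $w$ put $$\mathrm{Tail}(w;x_0,R)=\Big(R^{s_pp}\int_{\mathbb R^N\setminus B_R(x_0)}\frac{|w(x)|^{p-1}}{|x-x_0|^{N+s_pp}}\,dx\Big)^{\frac1{p-1}}.$$ A function $u\in W^{s_1,1}_{\rm loc}(\Omega)\cap W^{s_p,p}_{\rm loc}(\Omega)\cap L^{p-1}_{s_pp}(\mathbb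 R^N)$ is a weak solution of $(-\Delta_1)^{s_1}u+(-\Delta_p)^{s_p}u=0$ in $\Omega$ if there is $Z\in L^\infty(\mathbb R^N\times\mathbb R^N)$ with $Z(x,y)\in\mathrm{sgn}(u(x)-u(y))$ for a.e. $(x,y)$, where $\mathrm{sgn}(t)=\{t/|t|\}$ for $t\ne0$ and $\mathrm{sgn}(0)=[-1,1]$, such that $$\int_{\mathbb R^N}\!\int_{\mathbb R^N}Z(x,y)\frac{\varphi(x)-\varphi(y)}{|x-y|^{N+s_1}}\,dx\,dy+\int_{\mathbb R^N}\!\int_{\mathbb R^N}\frac{|u(x)-u(y)|^{p-2}(u(x)-u(y))(\varphi(x)-\varphi(y))}{|x-y|^{N+s_pp}}\,dx\,dy=0$$ for every $\varphi\in W^{s_1,1}(\mathbb R^N)\cap W^{s_p,p}(\mathbb R^N)$ with compact support in $\Omega$. For $r>0$ and $t\ge0$ let $$H_r(t)=\frac{t}{r^{s_1}}+\frac{t^p}{r^{s_pp}},\qquad h_r(t)=\frac1{r^{s_1}}+\frac{t^{p-1}}{r^{s_pp}},$$ and let $H_r^{-1},h_r^{-1}$ be their inverses, with $h_r^{-1}(y)=0$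 for $y<h_r(0)=r^{-s_1}$. Write $u_+=\max\{u,0\}$ and $u_-=\max\{-u,0\}$. Then every weak solution $u$ is locally bounded in $\Omega$, that is, essentially bounded on every compact subset of $\Omega$. Moreover, for every $\delta>0$ there is a constant $C_\delta>0$, depending only on $N,p,s_1,s_p$ and $\delta$, such that for every such $\Omega$, every weak solution $u$ in $\Omega$, and every ball with $r>0$ and $B_{2r}(x_0)\subset\subset\Omega$, $$\operatorname*{ess\,sup}_{B_{r/2}(x_0)}u_\pm\le C_\delta\,H_r^{-1}\Big(\frac1{|B_r(x_0)|}\int_{B_r(x_0)}H_r(u_\pm)\,dx\Big)+\delta\,h_r^{-1}\Big(r^{-s_pp}\big(\mathrm{Tail}(u;x_0,r/2)^{p-1}+1\big)\Big),$$ both for $u_+$ and for $u_-$. -/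

import Mathlib

open MeasureTheory Set

noncomputable section

/-- The Euclidean space of dimension `N`, with the Euclidean norm. -/
abbrev Eucl (N : ℕ) : Type := EuclideanSpace ℝ (Fin N)

/-- The `q`-th power of the Gagliardo seminorm of `w` on `S`, an extended nonnegative number:
the integral over `S × S` of `|w x - w y| ^ q / |x - y| ^ (N + γ q)`. -/
def gagliardo {N : ℕ} (γ q : ℝ) (S : Set (Eucl N)) (w : Eucl N → ℝ) : ENNReal :=
  ∫⁻ z in S ×ˢ S, ENNReal.ofReal (|w z.1 - w z.2| ^ q / ‖z.1 - z.2‖ ^ ((N : ℝ) + γ * q))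

/-- Membership in the fractional Sobolev space of order `γ` and exponent `q` on `S`. -/
def MemFracSobolev {N : ℕ} (γ q : ℝ) (S : Set (Eucl N)) (w : Eucl N → ℝ) : Prop :=
  MemLp w (ENNReal.ofReal q) (volume.restrict S) ∧ gagliardo γ q S w < ⊤

/-- Membership in the local fractional Sobolev space on `Ω`: membership on every open set that is
compactly contained in `Ω`. -/
def MemFracSobolevLoc {N : ℕ} (γ q : ℝ) (Ω : Set (Eucl N)) (w : Eucl N → ℝ) : Prop :=
  ∀ U : Set (Eucl N), IsOpen U → IsCompact (closure U) → closure U ⊆ Ω → MemFracSobolev γ q U w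

/-- Membership in the tail space of exponent `q` and weight index `γ`. -/
def MemTailSpace {N : ℕ} (q γ : ℝ) (w : Eucl N → ℝ) : Prop :=
  AEStronglyMeasurable w volume ∧
    LocallyIntegrable (fun x => |w x| ^ q) volume ∧
    Integrable (fun x => |w x| ^ q / (1 + ‖x‖) ^ ((N : ℝ) + γ)) volume

/-- The nonlocal tail of `u` outside the ball of centre `x₀` and radius `R`. -/
def Tail {N : ℕ} (p sp : ℝ) (u : Eucl N → ℝ) (x₀ : Eucl N) (R : ℝ) : ℝ :=
  (R ^ (sp * p) * ∫ x in (Metric.ball x₀ R)ᶜ,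
    |u x| ^ (p - 1) / ‖x - x₀‖ ^ ((N : ℝ) + sp * p)) ^ (1 / (p - 1))

/-- The set-valued sign function, with value `[-1, 1]` at `0`. -/
def sgnSet (t : ℝ) : Set ℝ := if t = 0 then Icc (-1) 1 else {Real.sign t}

/-- Weak solutions in `Ω` of the equation `(-Δ₁)^s₁ u + (-Δ_p)^s_p u = 0`. The test functions are
those of finite `W^{s₁,1}` and `W^{s_p,p}` norm on the whole space with compact support in `Ω`; for
them both integrands below are absolutely integrable, given the conditions on `u` and `Z`. -/
def IsWeakSolution {N : ℕ} (p s₁ sp : ℝ) (Ω : Set (Eucl N)) (u : Eucl N → ℝ) : Prop :=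
  MemFracSobolevLoc s₁ 1 Ω u ∧ MemFracSobolevLoc sp p Ω u ∧ MemTailSpace (p - 1) (sp * p) u ∧
  ∃ Z : Eucl N × Eucl N → ℝ,
    MemLp Z ⊤ volume ∧
    (∀ᵐ z : Eucl N × Eucl N, Z z ∈ sgnSet (u z.1 - u z.2)) ∧
    ∀ φ : Eucl N → ℝ,
      MemFracSobolev s₁ 1 univ φ → MemFracSobolev sp p univ φ →
      HasCompactSupport φ → tsupport φ ⊆ Ω →
      (∫ z : Eucl N × Eucl N,
          Z z * (φ z.1 - φ z.2) / ‖z.1 - z.2‖ ^ ((N : ℝ) + s₁)) +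
        (∫ z : Eucl N × Eucl N,
          |u z.1 - u z.2| ^ (p - 2) * (u z.1 - u z.2) * (φ z.1 - φ z.2) /
            ‖z.1 - z.2‖ ^ ((N : ℝ) + sp * p)) = 0

/-- Local boundedness in `Ω`: essentially bounded on every compact subset. -/
def IsLocallyBoundedIn {N : ℕ} (Ω : Set (Eucl N)) (u : Eucl N → ℝ) : Prop :=
  ∀ K : Set (Eucl N), IsCompact K → K ⊆ Ω →
    ∃ M : ℝ, ∀ᵐ x ∂(volume.restrict K), |u x| ≤ M

/-- `H_r(t) = t / r^s₁ + t^p / r^(s_p p)`. -/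
def bigH (p s₁ sp r t : ℝ) : ℝ := t / r ^ s₁ + t ^ p / r ^ (sp * p)

/-- `h_r(t) = 1 / r^s₁ + t^(p-1) / r^(s_p p)`. -/
def smallH (p s₁ sp r t : ℝ) : ℝ := 1 / r ^ s₁ + t ^ (p - 1) / r ^ (sp * p)

/-- The inverse of an increasing function `f` on `[0, ∞)`: the least `t ≥ 0` with `y ≤ f t`. It is
the usual inverse at the values of `f`, and it is `0` for `y` below `f 0`. -/
def incrInv (f : ℝ → ℝ) (y : ℝ) : ℝ := sInf {t : ℝ | 0 ≤ t ∧ y ≤ f t}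

theorem incrInv_apply {f : ℝ → ℝ} (hf : StrictMonoOn f (Ici 0)) {t : ℝ} (ht : 0 ≤ t) :
    incrInv f (f t) = t := by
  have h : {x : ℝ | 0 ≤ x ∧ f t ≤ f x} = Ici t := by
    ext x
    constructor
    · rintro ⟨h0, hx⟩
      exact (hf.le_iff_le ht h0).1 hx
    · intro hx
      have h0 : 0 ≤ x := le_trans ht hx
      exact ⟨h0, (hf.le_iff_le ht h0).2 hx⟩
  rw [incrInv, h, csInf_Ici]

end

/-! The proof is a De Giorgi iteration in which the powers of `u` are measured through the single
function `H_r`. Three ingredients feed it.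

The first is a Caccioppoli inequality (`exists_caccioppoli`). Testing the equation with `(u - k)_+ ψ
^ p` controls the sum of the `W^{s₁,1}` energy of `(u - k)_+ ψ ^ p` and the `W^{sp,p}` energy of `(u
- k)_+ ψ`. It rests on pointwise bounds for each operator (`abs_sub_le_sgn_mul`,
`caccioppoli_pointwise`, `neg_tail_le`). The cutoff keeps a positive distance between its support
and the complement of the ball, so every error kernel is truncated at the diagonal. Only the
`p`-part produces a tail, because `Z` is bounded by 1.

The second is a fractional Faber–Krahn inequality (`exists_lintegral_rpow_le_gagliardo`): a function
supported on a small set has norm bounded by a positive power of the measure of that set times its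
energy. No Sobolev embedding is used.

The third is the identity `H_r(t) = t h_r(t)` for `t ≥ 0`. On the superlevel set above `k + h`, the
truncation at `k` is at least `h`, so a tail bounded by a multiple of `h_r(lam * h)` turns the
linear term of the Caccioppoli inequality into a multiple of `H_r((u - k)_+)` (`level_pointwise`).

Together these give `Y (j + 1) ≤ A b ^ j Y j ^ (1 + ε)` with `ε = min s₁ (sp p) / N`, along levels
increasing to `K` and radii decreasing to `r / 2`. Hence `u ≤ K` on the half ball once the tail is
at most `M h_r(K)` and the average of `H_r(u_+)` is at most `ν H_r(K)`
(`exists_ae_le_of_lintegral_bigH_le`). Taking `K` just above `C` times the inverse `H_r`-average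
plus `δ` times the inverse of the tail meets both conditions: a small `δ` is paid for by a large
`M`, hence a small `ν` and a large `C`. The bound for `u_-` follows since `-u` is again a solution,
and local boundedness follows by compactness. -/

/-! ### Elementary inequalities for powers and for the sign -/

theorem Real.rpow_sub_rpow_le {p s t : ℝ} (hp : 1 ≤ p) (hs : 0 ≤ s) (ht : 0 < t) :
    t ^ p - s ^ p ≤ p * t ^ (p - 1) * (t - s) := by
  have h := one_add_mul_self_le_rpow_one_add (s := s / t - 1)
    (by have := div_nonneg hs ht.le; linarith) hp
  have e : (1 + (s / t - 1)) = s / t := by ring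
  rw [e, Real.div_rpow hs ht.le, le_div_iff₀ (Real.rpow_pos_of_pos ht p)] at h
  have e2 : t ^ p = t ^ (p - 1) * t := by
    rw [← Real.rpow_add_one ht.ne']; congr 1; ring
  have e3 : (1 + p * (s / t - 1)) * t ^ p = t ^ p - p * t ^ (p - 1) * (t - s) := by
    rw [e2]; field_simp; ring
  linarith

theorem abs_rpow_sub_rpow_le {p s t : ℝ} (hp : 1 ≤ p) (hs : s ∈ Icc (0 : ℝ) 1)
    (ht : t ∈ Icc (0 : ℝ) 1) : |s ^ p - t ^ p| ≤ p * |s - t| := by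
  wlog hst : s ≤ t generalizing s t
  · rw [abs_sub_comm, abs_sub_comm s]; exact this ht hs (le_of_not_ge hst)
  have hpow : s ^ p ≤ t ^ p := Real.rpow_le_rpow hs.1 hst (by linarith)
  rw [abs_sub_comm, abs_sub_comm s, abs_of_nonneg (by linarith), abs_of_nonneg (by linarith)]
  rcases ht.1.eq_or_lt with h0 | h0
  · have : s = t := le_antisymm hst (h0 ▸ hs.1)
    simp [this]
  · refine (Real.rpow_sub_rpow_le hp hs.1 h0).trans ?_
    have : t ^ (p - 1) ≤ 1 := Real.rpow_le_one h0.le ht.2 (by linarith)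
    have h1 : p * t ^ (p - 1) ≤ p * 1 := by gcongr
    have := mul_le_mul_of_nonneg_right h1 (by linarith : 0 ≤ t - s)
    linarith

/-- The sum is at most twice the larger term. This crude argument needs no convexity, so it also
covers the exponent `p - 1` when it is below 1. -/
theorem add_rpow_le_two_rpow_mul {q a b : ℝ} (hq : 0 ≤ q) (ha : 0 ≤ a) (hb : 0 ≤ b) :
    (a + b) ^ q ≤ 2 ^ q * (a ^ q + b ^ q) := by
  wlog hab : a ≤ b generalizing a b
  · rw [add_comm a, add_comm (a ^ q)]; exact this hb ha (le_of_not_ge hab)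
  calc (a + b) ^ q ≤ (2 * b) ^ q := Real.rpow_le_rpow (by linarith) (by linarith) hq
    _ = 2 ^ q * b ^ q := Real.mul_rpow (by norm_num) hb
    _ ≤ _ := by
      have : 0 ≤ a ^ q := Real.rpow_nonneg ha q
      gcongr; linarith

theorem rpow_sub_one_mul_self {p x : ℝ} (hp : 1 < p) (hx : 0 ≤ x) : x ^ (p - 1) * x = x ^ p := by
  rcases hx.eq_or_lt with rfl | h
  · rw [Real.zero_rpow (by linarith), Real.zero_rpow (by linarith)]; simp
  · rw [← Real.rpow_add_one h.ne']; congr 1; ring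

/-- A Young inequality whose coefficient 1/2 permits absorption: either `y ≤ x / 2`, or `x` is
dominated by `2 * y`. -/
theorem rpow_sub_one_mul_le {p x y : ℝ} (hp : 1 < p) (hx : 0 ≤ x) (hy : 0 ≤ y) :
    x ^ (p - 1) * y ≤ x ^ p / 2 + 2 ^ (p - 1) * y ^ p := by
  rcases le_total y (x / 2) with h | h
  · have h1 : x ^ (p - 1) * y ≤ x ^ (p - 1) * (x / 2) := by gcongr
    have h2 := rpow_sub_one_mul_self hp hx
    have : 0 ≤ 2 ^ (p - 1) * y ^ p := by positivity
    nlinarith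
  · have h1 : x ^ (p - 1) ≤ (2 * y) ^ (p - 1) :=
      Real.rpow_le_rpow hx (by linarith) (by linarith)
    rw [Real.mul_rpow (by norm_num) hy] at h1
    have h2 := rpow_sub_one_mul_self hp hy
    have h3 := mul_le_mul_of_nonneg_right h1 hy
    rw [mul_assoc, h2] at h3
    have : 0 ≤ x ^ p := by positivity
    linarith

theorem rpow_sub_one_mul_le_add {p x y : ℝ} (hp : 1 < p) (hx : 0 ≤ x) (hy : 0 ≤ y) :
    x ^ (p - 1) * y ≤ x ^ p + y ^ p := by
  rcases le_total y x with h | h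
  · have h1 : x ^ (p - 1) * y ≤ x ^ (p - 1) * x := by gcongr
    have h2 := rpow_sub_one_mul_self hp hx
    have : 0 ≤ y ^ p := by positivity
    linarith
  · have h1 : x ^ (p - 1) * y ≤ y ^ (p - 1) * y := by
      gcongr
    have h2 := rpow_sub_one_mul_self hp hy
    have : 0 ≤ x ^ p := by positivity
    linarith

theorem abs_rpow_mul_self_eq {p t : ℝ} (hp : 1 < p) :
    |(|t| ^ (p - 2) * t)| = |t| ^ (p - 1) := by
  rcases eq_or_ne t 0 with rfl | h
  · simp [Real.zero_rpow (by linarith : p - 1 ≠ 0)]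
  · rw [abs_mul, abs_of_nonneg (by positivity), ← Real.rpow_add_one (abs_pos.2 h).ne']
    congr 1; ring

theorem abs_rpow_mul_self_of_nonneg {p t : ℝ} (hp : 1 < p) (ht : 0 ≤ t) :
    |t| ^ (p - 2) * t = t ^ (p - 1) := by
  have h := abs_rpow_mul_self_eq (t := t) hp
  rw [abs_of_nonneg (show 0 ≤ |t| ^ (p - 2) * t by positivity)] at h
  rwa [abs_of_nonneg ht] at h ⊢

theorem abs_le_one_of_mem_sgnSet {Z t : ℝ} (h : Z ∈ sgnSet t) : |Z| ≤ 1 := by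
  unfold sgnSet at h
  split_ifs at h with h0
  · exact abs_le.2 h
  · rw [mem_singleton_iff] at h
    rcases lt_or_gt_of_ne h0 with h1 | h1
    · simp [h, Real.sign_of_neg h1]
    · simp [h, Real.sign_of_pos h1]

theorem neg_mem_sgnSet {Z t : ℝ} (h : Z ∈ sgnSet t) : -Z ∈ sgnSet (-t) := by
  unfold sgnSet at *
  simp only [neg_eq_zero]
  split_ifs at h ⊢ with h0
  · exact ⟨by linarith [h.2], by linarith [h.1]⟩
  · rw [mem_singleton_iff] at h ⊢
    rw [h, Real.sign_neg]

/-- Pointwise Caccioppoli bound for the 1-Laplacian, with `s`, `t` the cutoff values. For `b < a`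
one has `Z = 1`, and the weighted difference can be negative only through `t - s`. For `a = b`
nothing is known of `Z` beyond `|Z| ≤ 1`, but the truncations agree and only `s - t` remains. -/
theorem abs_sub_le_sgn_mul {Z a b k s t : ℝ} (hZ : Z ∈ sgnSet (a - b)) (hs : 0 ≤ s) (ht : 0 ≤ t) :
    |max (a - k) 0 * s - max (b - k) 0 * t| ≤
      Z * (max (a - k) 0 * s - max (b - k) 0 * t) +
        2 * ((max (a - k) 0 + max (b - k) 0) * |s - t|) := by
  wlog hab : b ≤ a generalizing a b s t Z
  · have h := this (Z := -Z) (a := b) (b := a) (by simpa using neg_mem_sgnSet hZ) ht hs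
      (le_of_not_ge hab)
    rw [abs_sub_comm, abs_sub_comm s]
    linarith
  have hZ1 := abs_le.1 (abs_le_one_of_mem_sgnSet hZ)
  have hw : max (b - k) 0 ≤ max (a - k) 0 := max_le_max (by linarith) le_rfl
  have hb0 : 0 ≤ max (b - k) 0 := le_max_right _ _
  have hst := le_abs_self (s - t)
  have hst' := neg_abs_le (s - t)
  rcases hab.eq_or_lt with rfl | hlt
  · have e : max (b - k) 0 * s - max (b - k) 0 * t = max (b - k) 0 * (s - t) := by ring
    rw [e, abs_mul, abs_of_nonneg hb0]
    have : -(max (b - k) 0 * |s - t|) ≤ Z * (max (b - k) 0 * (s - t)) := by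
      rw [neg_le]
      refine (neg_le_abs _).trans ?_
      rw [abs_mul, abs_mul, abs_of_nonneg hb0]
      exact mul_le_of_le_one_left (by positivity) (abs_le.2 hZ1)
    have : 0 ≤ max (b - k) 0 * |s - t| := by positivity
    linarith
  · have hZ' : Z = 1 := by
      have h0 : a - b ≠ 0 := by linarith
      simpa [sgnSet, h0, Real.sign_of_pos (sub_pos.2 hlt)] using hZ
    rw [hZ', one_mul]
    generalize max (a - k) 0 = w at *
    generalize max (b - k) 0 = v at *
    have : 0 ≤ v * |s - t| := by positivity
    have h3 : w * (t - s) ≤ w * |s - t| :=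
      mul_le_mul_of_nonneg_left (by linarith) (hb0.trans hw)
    have h4 : 0 ≤ w * |s - t| := mul_nonneg (hb0.trans hw) (abs_nonneg _)
    rcases le_total 0 (w * s - v * t) with h | h
    · rw [abs_of_nonneg h]; linarith
    · rw [abs_of_nonpos h]
      have := mul_le_mul_of_nonneg_right hw ht
      linarith

/-- If `t ≤ s`, monotonicity gives `(w - v) * s ^ p ≤ w * s ^ p - v * t ^ p`. If `s ≤ t`, the loss
`w * (t ^ p - s ^ p)` is linearised by the tangent inequality, and Young's inequality absorbs half
of `(w - v) ^ p * t ^ p`. -/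
theorem caccioppoli_pointwise_aux {p w v s t : ℝ} (hp : 1 < p) (hv : 0 ≤ v) (hvw : v ≤ w)
    (hs : 0 ≤ s) (ht : 0 ≤ t) :
    |w * s - v * t| ^ p ≤ 2 ^ p * (2 * ((w - v) ^ (p - 1) * (w * s ^ p - v * t ^ p)) +
      (2 * (2 ^ (p - 1) * p ^ p) + 1) * (w ^ p * |s - t| ^ p)) := by
  have hp0 : 0 ≤ p := by linarith
  have hw : 0 ≤ w := hv.trans hvw
  have hd : 0 ≤ w - v := by linarith
  have hdp := rpow_sub_one_mul_self hp hd
  have hb : |w * s - v * t| ^ p ≤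
      2 ^ p * (((w - v) * max s t) ^ p + (w * |s - t|) ^ p) := by
    refine le_trans ?_ (add_rpow_le_two_rpow_mul hp0 (by positivity) (by positivity))
    refine Real.rpow_le_rpow (abs_nonneg _) ?_ hp0
    have e : w * s - v * t = (w - v) * t + w * (s - t) := by ring
    rw [e]
    refine (abs_add_le _ _).trans ?_
    rw [abs_mul, abs_mul, abs_of_nonneg hw, abs_of_nonneg hd, abs_of_nonneg ht]
    gcongr
    exact le_max_right _ _
  refine hb.trans ?_
  rw [Real.mul_rpow hw (abs_nonneg _), Real.mul_rpow hd (by positivity)]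
  refine mul_le_mul_of_nonneg_left ?_ (by positivity)
  have he : 0 ≤ w ^ p * |s - t| ^ p := by positivity
  have hc : 0 ≤ 2 ^ (p - 1) * p ^ p := by positivity
  have hce := mul_nonneg hc he
  rcases le_total t s with h | h
  · rw [max_eq_left h]
    have h1 : t ^ p ≤ s ^ p := Real.rpow_le_rpow ht h hp0
    have h2 : (w - v) * s ^ p ≤ w * s ^ p - v * t ^ p := by
      have := mul_le_mul_of_nonneg_left h1 hv
      linarith
    have h3 := mul_le_mul_of_nonneg_left h2 (by positivity : 0 ≤ (w - v) ^ (p - 1))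
    rw [← mul_assoc, hdp] at h3
    have : 0 ≤ (w - v) ^ p * s ^ p := by positivity
    linarith
  · rw [max_eq_right h]
    rcases ht.eq_or_lt with h0 | h0
    · have hs0 : s = 0 := le_antisymm (h0 ▸ h) hs
      simp [hs0, ← h0, Real.zero_rpow (by linarith : p ≠ 0)]
    have h1 := Real.rpow_sub_rpow_le hp.le hs h0
    have h2 : (w - v) ^ (p - 1) * (w * (p * t ^ (p - 1) * (t - s))) ≤
        (w - v) ^ p * t ^ p / 2 + 2 ^ (p - 1) * p ^ p * (w ^ p * |s - t| ^ p) := by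
      have h3 := rpow_sub_one_mul_le (x := (w - v) * t) (y := p * (w * |s - t|)) hp
        (by positivity) (by positivity)
      rw [Real.mul_rpow hd ht, Real.mul_rpow hd ht, Real.mul_rpow hp0 (by positivity),
        Real.mul_rpow hw (by positivity), abs_sub_comm, abs_of_nonneg (sub_nonneg.2 h)] at h3
      rw [abs_sub_comm, abs_of_nonneg (sub_nonneg.2 h)]
      linarith
    have h4 := mul_le_mul_of_nonneg_left h1 (by positivity : 0 ≤ (w - v) ^ (p - 1) * w)
    have h5 : (w - v) ^ (p - 1) * (w * s ^ p - v * t ^ p) =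
        (w - v) ^ p * t ^ p - (w - v) ^ (p - 1) * w * (t ^ p - s ^ p) := by
      rw [← hdp]; ring
    rw [h5]
    linarith

/-- After ordering `b ≤ a`, the truncated increment may be replaced by `a - b`: for `b ≤ k` the
lower truncation vanishes and the bracket is nonnegative, while for `b ≥ k` the two increments
coincide. -/
theorem caccioppoli_pointwise {p a b k s t : ℝ} (hp : 1 < p) (hs : 0 ≤ s) (ht : 0 ≤ t) :
    |max (a - k) 0 * s - max (b - k) 0 * t| ^ p ≤
      2 ^ p * (2 * (|a - b| ^ (p - 2) * (a - b) * (max (a - k) 0 * s ^ p - max (b - k) 0 * t ^ p)) +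
      (2 * (2 ^ (p - 1) * p ^ p) + 1) * ((max (a - k) 0 + max (b - k) 0) ^ p * |s - t| ^ p)) := by
  wlog hab : b ≤ a generalizing a b s t
  · have h := this (a := b) (b := a) ht hs (le_of_not_ge hab)
    rw [abs_sub_comm, abs_sub_comm s, abs_sub_comm a b, add_comm (max (a - k) 0)]
    refine h.trans (le_of_eq ?_)
    ring
  have hp0 : 0 ≤ p := by linarith
  rw [abs_rpow_mul_self_of_nonneg hp (sub_nonneg.2 hab)]
  have hv : 0 ≤ max (b - k) 0 := le_max_right _ _
  have hvw : max (b - k) 0 ≤ max (a - k) 0 := max_le_max (by linarith) le_rfl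
  have hD : max (a - k) 0 - max (b - k) 0 ≤ a - b := by
    rcases max_cases (a - k) 0 with h | h <;> rcases max_cases (b - k) 0 with h' | h' <;> linarith
  refine (caccioppoli_pointwise_aux hp hv hvw hs ht).trans ?_
  have h1 : (max (a - k) 0 - max (b - k) 0) ^ (p - 1) *
      (max (a - k) 0 * s ^ p - max (b - k) 0 * t ^ p) ≤
      (a - b) ^ (p - 1) * (max (a - k) 0 * s ^ p - max (b - k) 0 * t ^ p) := by
    rcases le_total b k with hb | hb
    · rw [max_eq_right (by linarith : b - k ≤ 0)] at hD ⊢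
      have : 0 ≤ max (a - k) 0 := le_max_right _ _
      have h0 : 0 ≤ max (a - k) 0 * s ^ p := by positivity
      simp only [zero_mul, sub_zero] at *
      gcongr
    · rw [max_eq_left (by linarith : 0 ≤ b - k), max_eq_left (by linarith : 0 ≤ a - k)]
      simp
  have hw0 : 0 ≤ max (a - k) 0 := le_max_right _ _
  have h2 : (max (a - k) 0) ^ p ≤ (max (a - k) 0 + max (b - k) 0) ^ p :=
    Real.rpow_le_rpow hw0 (by linarith) hp0
  gcongr

/-- The product is negative only when `b > a > k ≥ 0`, and then `|a - b| ≤ |b|`. The nonnegativity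
of the level is what keeps `a` out of the tail. -/
theorem neg_tail_le {p a b k c : ℝ} (hp : 1 < p) (hk : 0 ≤ k) (hc : 0 ≤ c) :
    0 ≤ |a - b| ^ (p - 2) * (a - b) * (max (a - k) 0 * c) + |b| ^ (p - 1) * (max (a - k) 0 * c) := by
  rcases le_total a k with h | h
  · simp [max_eq_right (by linarith : a - k ≤ 0)]
  · rw [← add_mul]
    have hw0 : 0 ≤ max (a - k) 0 := le_max_right _ _
    refine mul_nonneg ?_ (by positivity)
    rcases le_total b a with hb | hb
    · have : 0 ≤ a - b := by linarith
      positivity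
    · have h1 : |a - b| ^ (p - 1) ≤ |b| ^ (p - 1) := by
        refine Real.rpow_le_rpow (abs_nonneg _) ?_ (by linarith)
        rw [abs_of_nonpos (by linarith), abs_of_nonneg (by linarith)]; linarith
      have h2 := abs_rpow_mul_self_eq (t := a - b) hp
      have h3 := neg_abs_le (|a - b| ^ (p - 2) * (a - b))
      linarith

/-! ### Kernel integrals and the Faber–Krahn inequality -/

/-- The truncated singular kernel is integrable, with the expected dependence on the scale. -/
theorem exists_lintegral_truncated_kernel_le {N : ℕ} (hN : 0 < N) {a q : ℝ} (ha : 0 < a)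
    (haq : a < q) : ∃ C : ℝ, 0 < C ∧ ∀ (L : ℝ), 0 < L → ∀ x : Eucl N,
      ∫⁻ y, ENNReal.ofReal ((min 1 (L * ‖x - y‖)) ^ q / ‖x - y‖ ^ ((N : ℝ) + a)) ≤
        ENNReal.ofReal (C * L ^ a) := by
  have : Nontrivial (Eucl N) := by
    apply Module.nontrivial_of_finrank_pos (R := ℝ)
    simpa using hN
  set f : ℝ → ℝ := fun t => (min 1 t) ^ q / t ^ ((N : ℝ) + a) with hf
  have hint : Integrable (fun z : Eucl N => f ‖z‖) volume := by
    -- In polar coordinates the density is `t ^ (q - 1 - a)` near 0, integrable since `a < q`, and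
    -- `t ^ (-1 - a)` at infinity, integrable since `0 < a`.
    rw [integrable_fun_norm_addHaar, finrank_euclideanSpace_fin,
      ← Ioc_union_Ioi_eq_Ioi (zero_le_one' ℝ)]
    have e : ∀ t : ℝ, 0 < t → t ^ (N - 1) * (t ^ ((N : ℝ) + a))⁻¹ = t ^ (-1 - a) := by
      intro t ht
      rw [← Real.rpow_natCast, ← Real.rpow_neg ht.le, ← Real.rpow_add ht, Nat.cast_sub hN]
      congr 1; push_cast; ring
    refine IntegrableOn.union ?_ ?_
    · have h1 : IntegrableOn (fun t : ℝ => t ^ (q - 1 - a)) (Ioc 0 1) := by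
        rw [integrableOn_Ioc_iff_integrableOn_Ioo,
          intervalIntegral.integrableOn_Ioo_rpow_iff one_pos]
        linarith
      refine h1.congr_fun ?_ measurableSet_Ioc
      intro t ht
      simp only [hf, smul_eq_mul, min_eq_right ht.2]
      rw [div_eq_mul_inv, mul_left_comm, e t ht.1, ← Real.rpow_add ht.1]
      congr 1; ring
    · have h1 : IntegrableOn (fun t : ℝ => t ^ (-1 - a)) (Ioi 1) :=
        integrableOn_Ioi_rpow_of_lt (by linarith) one_pos
      refine h1.congr_fun ?_ measurableSet_Ioi
      intro t ht
      simp only [hf, smul_eq_mul, min_eq_left (le_of_lt (mem_Ioi.1 ht)), Real.one_rpow, one_div]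
      rw [e t (one_pos.trans ht)]
  have hf0 : ∀ t, 0 ≤ t → 0 ≤ f t := fun t ht => by simp only [hf]; positivity
  refine ⟨(∫ z : Eucl N, f ‖z‖) + 1, by
    have := integral_nonneg (μ := volume) (f := fun z : Eucl N => f ‖z‖)
      (fun z => hf0 _ (norm_nonneg z))
    linarith, fun L hL x => ?_⟩
  have hscale : ∀ z : Eucl N, (min 1 (L * ‖z‖)) ^ q / ‖z‖ ^ ((N : ℝ) + a) =
      L ^ ((N : ℝ) + a) * f ‖L • z‖ := by
    intro z
    simp only [hf, norm_smul, Real.norm_of_nonneg hL.le]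
    rw [Real.mul_rpow hL.le (norm_nonneg _)]
    have : L ^ ((N : ℝ) + a) ≠ 0 := (Real.rpow_pos_of_pos hL _).ne'
    field_simp
  have hint' : Integrable (fun z : Eucl N => (min 1 (L * ‖z‖)) ^ q / ‖z‖ ^ ((N : ℝ) + a)) := by
    simp only [hscale]
    exact ((integrable_comp_smul_iff volume (fun z : Eucl N => f ‖z‖) hL.ne').2 hint).const_mul _
  rw [lintegral_sub_left_eq_self
    (fun z : Eucl N => ENNReal.ofReal ((min 1 (L * ‖z‖)) ^ q / ‖z‖ ^ ((N : ℝ) + a))) x,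
    ← ofReal_integral_eq_lintegral_ofReal hint' (Filter.Eventually.of_forall fun z => by
      have : 0 ≤ min 1 (L * ‖z‖) := by positivity
      simp only [Pi.zero_apply]; positivity)]
  refine ENNReal.ofReal_le_ofReal ?_
  simp only [hscale]
  rw [integral_const_mul, Measure.integral_comp_smul volume (fun z : Eucl N => f ‖z‖) L,
    finrank_euclideanSpace_fin, smul_eq_mul, abs_of_nonneg (by positivity), ← mul_assoc,
    Real.rpow_add hL, Real.rpow_natCast, mul_comm (L ^ N), mul_assoc (L ^ a),
    mul_inv_cancel₀ (by positivity), mul_one, mul_comm]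
  gcongr
  linarith

/-- A fractional Faber–Krahn inequality for functions supported on a set of finite measure. -/
theorem exists_lintegral_rpow_le_gagliardo {N : ℕ} (hN : 0 < N) {γ q : ℝ} (hγ : 0 < γ)
    (hq : 0 < q) : ∃ C : ℝ, 0 < C ∧ ∀ (f : Eucl N → ℝ), Measurable f → ∀ e : ℝ, 0 < e →
      volume {x | f x ≠ 0} ≤ ENNReal.ofReal e →
      ∫⁻ x, ENNReal.ofReal (|f x| ^ q) ≤
        ENNReal.ofReal (C * e ^ (γ * q / N)) * gagliardo γ q univ f := by
  have : Nontrivial (Eucl N) := by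
    apply Module.nontrivial_of_finrank_pos (R := ℝ)
    simpa using hN
  set ω : ℝ := (volume (Metric.ball (0 : Eucl N) 1)).toReal with hω
  have hωpos : 0 < ω := ENNReal.toReal_pos (Metric.measure_ball_pos _ _ one_pos).ne'
    measure_ball_lt_top.ne
  have hNr : (0 : ℝ) < N := by exact_mod_cast hN
  refine ⟨(2 / ω) ^ (γ * q / N) * (2 / ω), by positivity, fun f hf e he hE => ?_⟩
  set E : Set (Eucl N) := {x | f x ≠ 0} with hEdef
  have hEm : MeasurableSet E := (measurableSet_singleton (0 : ℝ)).compl.preimage hf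
  -- The ball of radius `R` has volume `2 * e`, so at least `e` of it lies outside the support `E`.
  -- There `f y = 0` and `‖x - y‖ ≤ R`, which bounds the inner integral of the seminorm from below.
  set R : ℝ := (2 * e / ω) ^ (1 / (N : ℝ)) with hR
  have hRpos : 0 < R := by positivity
  have hRN : R ^ N = 2 * e / ω := by
    rw [hR, ← Real.rpow_natCast, ← Real.rpow_mul (by positivity), one_div_mul_cancel hNr.ne',
      Real.rpow_one]
  have hball : ∀ x : Eucl N, ENNReal.ofReal e ≤ volume (Metric.ball x R \ E) := by
    intro x
    have h1 : volume (Metric.ball x R) = ENNReal.ofReal (2 * e) := by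
      rw [Measure.addHaar_ball volume x hRpos.le, finrank_euclideanSpace_fin, hRN,
        ← ENNReal.ofReal_toReal (measure_ball_lt_top (μ := volume) (x := (0 : Eucl N))).ne, ← hω,
        ← ENNReal.ofReal_mul (by positivity)]
      congr 1; field_simp
    have h2 := le_measure_sdiff (μ := volume) (s₁ := Metric.ball x R) (s₂ := E)
    rw [h1] at h2
    refine le_trans ?_ h2
    have h3 : ENNReal.ofReal (2 * e) = ENNReal.ofReal e + ENNReal.ofReal e := by
      rw [← ENNReal.ofReal_add he.le he.le]; congr 1; ring
    rw [h3]
    exact ENNReal.le_sub_of_add_le_left (ne_top_of_le_ne_top ENNReal.ofReal_ne_top hE)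
      (by gcongr)
  have hpt : ∀ x : Eucl N, ENNReal.ofReal (|f x| ^ q) * ENNReal.ofReal (e * (R ^ ((N : ℝ) + γ * q))⁻¹) ≤
      ∫⁻ y, ENNReal.ofReal (|f x - f y| ^ q / ‖x - y‖ ^ ((N : ℝ) + γ * q)) := by
    intro x
    by_cases hx : f x = 0
    · simp [hx, Real.zero_rpow hq.ne']
    calc ENNReal.ofReal (|f x| ^ q) * ENNReal.ofReal (e * (R ^ ((N : ℝ) + γ * q))⁻¹)
        = ENNReal.ofReal (|f x| ^ q / R ^ ((N : ℝ) + γ * q)) * ENNReal.ofReal e := by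
          rw [← ENNReal.ofReal_mul (by positivity), ← ENNReal.ofReal_mul (by positivity)]
          congr 1; ring
      _ ≤ ENNReal.ofReal (|f x| ^ q / R ^ ((N : ℝ) + γ * q)) * volume (Metric.ball x R \ E) := by
          gcongr; exact hball x
      _ = ∫⁻ y in Metric.ball x R \ E, ENNReal.ofReal (|f x| ^ q / R ^ ((N : ℝ) + γ * q)) := by
          rw [setLIntegral_const]
      _ ≤ ∫⁻ y in Metric.ball x R \ E,
          ENNReal.ofReal (|f x - f y| ^ q / ‖x - y‖ ^ ((N : ℝ) + γ * q)) := by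
          refine setLIntegral_mono' (Metric.isOpen_ball.measurableSet.diff hEm) fun y hy => ?_
          have hy0 : f y = 0 := by simpa [hEdef] using hy.2
          have hxy : 0 < ‖x - y‖ := by
            rw [norm_pos_iff, sub_ne_zero]
            rintro rfl
            exact hx hy0
          have : ‖x - y‖ ≤ R := by
            have := Metric.mem_ball'.1 hy.1
            rw [dist_eq_norm] at this
            exact this.le
          rw [hy0, sub_zero]
          gcongr
      _ ≤ _ := setLIntegral_le_lintegral _ _
  have hg : gagliardo γ q univ f = ∫⁻ x, ∫⁻ y,
      ENNReal.ofReal (|f x - f y| ^ q / ‖x - y‖ ^ ((N : ℝ) + γ * q)) := by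
    rw [gagliardo, univ_prod_univ, Measure.restrict_univ, Measure.volume_eq_prod, lintegral_prod]
    fun_prop
  have hmain : (∫⁻ x, ENNReal.ofReal (|f x| ^ q)) * ENNReal.ofReal (e * (R ^ ((N : ℝ) + γ * q))⁻¹) ≤
      gagliardo γ q univ f := by
    rw [hg, ← lintegral_mul_const _ (by fun_prop)]
    exact lintegral_mono hpt
  have hconst : (2 / ω) ^ (γ * q / N) * (2 / ω) * e ^ (γ * q / N) *
      (e * (R ^ ((N : ℝ) + γ * q))⁻¹) = 1 := by
    rw [Real.rpow_add hRpos, Real.rpow_natCast, hRN]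
    have : R ^ (γ * q) = (2 / ω) ^ (γ * q / N) * e ^ (γ * q / N) := by
      rw [hR, ← Real.rpow_mul (by positivity), ← Real.mul_rpow (by positivity) he.le]
      congr 1 <;> ring
    rw [this]
    have : 0 < (2 / ω) ^ (γ * q / N) := by positivity
    field_simp
  calc ∫⁻ x, ENNReal.ofReal (|f x| ^ q)
      = ENNReal.ofReal ((2 / ω) ^ (γ * q / N) * (2 / ω) * e ^ (γ * q / N)) *
        ((∫⁻ x, ENNReal.ofReal (|f x| ^ q)) *
          ENNReal.ofReal (e * (R ^ ((N : ℝ) + γ * q))⁻¹)) := by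
        rw [mul_comm (∫⁻ x, _), ← mul_assoc, ← ENNReal.ofReal_mul (by positivity), hconst]
        simp
    _ ≤ _ := by gcongr

/-! ### Cutoff functions -/

/-- A cutoff function for `B` at the scale `1 / L`: it takes values in `[0, 1]`, is `L`-Lipschitz,
and its support has distance at least `1 / L` to the complement of `B`. -/
structure IsCutoff {N : ℕ} (B : Set (Eucl N)) (L : ℝ) (ψ : Eucl N → ℝ) : Prop where
  mem_Icc : ∀ x, ψ x ∈ Icc (0 : ℝ) 1
  abs_sub_le : ∀ x y, |ψ x - ψ y| ≤ min 1 (L * ‖x - y‖)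
  gap : ∀ x y, ψ x ≠ 0 → y ∉ B → 1 ≤ L * ‖x - y‖

namespace IsCutoff

variable {N : ℕ} {B : Set (Eucl N)} {L : ℝ} {ψ : Eucl N → ℝ}

theorem eq_zero (h : IsCutoff B L ψ) {x : Eucl N} (hx : x ∉ B) : ψ x = 0 := by
  by_contra h0
  have := h.gap x x h0 hx
  simp at this
  linarith

theorem continuous (h : IsCutoff B L ψ) (hL : 0 ≤ L) : Continuous ψ := by
  have : LipschitzWith (Real.toNNReal L) ψ := by
    refine LipschitzWith.of_dist_le_mul fun x y => ?_
    rw [Real.dist_eq, dist_eq_norm, Real.coe_toNNReal L hL]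
    exact (h.abs_sub_le x y).trans (min_le_right _ _)
  exact this.continuous

/-- The test function carries `ψ ^ p`, which must itself be an admissible cutoff. The scale grows by
the factor `p`, and this only weakens the gap condition. -/
theorem rpow (h : IsCutoff B L ψ) {p : ℝ} (hp : 1 ≤ p) :
    IsCutoff B (p * L) (fun x => ψ x ^ p) where
  mem_Icc x := ⟨Real.rpow_nonneg (h.mem_Icc x).1 _,
    Real.rpow_le_one (h.mem_Icc x).1 (h.mem_Icc x).2 (by linarith)⟩
  abs_sub_le x y := by
    have h0 : ∀ x, 0 ≤ ψ x ^ p ∧ ψ x ^ p ≤ 1 := fun x => ⟨Real.rpow_nonneg (h.mem_Icc x).1 _,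
      Real.rpow_le_one (h.mem_Icc x).1 (h.mem_Icc x).2 (by linarith)⟩
    refine le_min ?_ ?_
    · have := h0 x
      have := h0 y
      rw [abs_le]; constructor <;> linarith
    · refine (abs_rpow_sub_rpow_le hp (h.mem_Icc x) (h.mem_Icc y)).trans ?_
      rw [mul_assoc]
      exact mul_le_mul_of_nonneg_left ((h.abs_sub_le x y).trans (min_le_right _ _)) (by linarith)
  gap x y hx hy := by
    have hx' : ψ x ≠ 0 := by
      intro h0
      rw [h0, Real.zero_rpow (by linarith)] at hx
      exact hx rfl
    have h1 := h.gap x y hx' hy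
    nlinarith [norm_nonneg (x - y)]

end IsCutoff

/-! ### Truncated kernels and double integrals -/

/-- The singular kernel of order `a`, truncated at the diagonal at the scale `1 / L`. -/
noncomputable def truncKernel {N : ℕ} (a q L : ℝ) (z : Eucl N × Eucl N) : ℝ :=
  (min 1 (L * ‖z.1 - z.2‖)) ^ q / ‖z.1 - z.2‖ ^ ((N : ℝ) + a)

section Product

variable {N : ℕ}

theorem truncKernel_nonneg {a q L : ℝ} (hL : 0 ≤ L) (z : Eucl N × Eucl N) :
    0 ≤ truncKernel a q L z := by
  unfold truncKernel
  positivity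

@[fun_prop]
theorem measurable_truncKernel {a q L : ℝ} :
    Measurable (truncKernel a q L : Eucl N × Eucl N → ℝ) := by
  unfold truncKernel
  fun_prop

theorem truncKernel_swap (a q L : ℝ) (z : Eucl N × Eucl N) :
    truncKernel a q L z.swap = truncKernel a q L z := by
  simp [truncKernel, norm_sub_rev]

/-- This is the use of the gap condition: between the support of a cutoff and the complement of `B`,
the truncated kernel is the full kernel. -/
theorem truncKernel_eq {a q L : ℝ} {z : Eucl N × Eucl N} (h : 1 ≤ L * ‖z.1 - z.2‖) :
    truncKernel a q L z = 1 / ‖z.1 - z.2‖ ^ ((N : ℝ) + a) := by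
  simp [truncKernel, min_eq_left h]

/-- Tonelli. The kernel bound is required only where `g` is nonzero, since the tail kernel is
controlled only from the support of the cutoff. -/
theorem lintegral_fst_mul_le {g : Eucl N → ENNReal} (hg : Measurable g)
    {κ : Eucl N × Eucl N → ENNReal} (hκ : Measurable κ) {K : ENNReal}
    (hK : ∀ x, g x ≠ 0 → ∫⁻ y, κ (x, y) ≤ K) : ∫⁻ z, g z.1 * κ z ≤ (∫⁻ x, g x) * K := by
  rw [Measure.volume_eq_prod, lintegral_prod _ (by fun_prop), ← lintegral_mul_const _ hg]
  refine lintegral_mono fun x => ?_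
  simp only
  rw [lintegral_const_mul _ (by fun_prop)]
  rcases eq_or_ne (g x) 0 with h | h
  · simp [h]
  · gcongr
    exact hK x h

theorem lintegral_snd_mul_le {g : Eucl N → ENNReal} (hg : Measurable g)
    {κ : Eucl N × Eucl N → ENNReal} (hκ : Measurable κ) {K : ENNReal}
    (hK : ∀ x, g x ≠ 0 → ∫⁻ y, κ (y, x) ≤ K) : ∫⁻ z, g z.2 * κ z ≤ (∫⁻ x, g x) * K := by
  have h := lintegral_fst_mul_le hg (κ := fun z => κ z.swap) (by fun_prop) hK
  refine le_trans (le_of_eq ?_) h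
  rw [Measure.volume_eq_prod, ← lintegral_prod_swap]
  simp

/-- The double integral of `(g x + g y)` against the truncated kernel. -/
theorem exists_lintegral_mul_truncKernel_le (hN : 0 < N) {a q : ℝ} (ha : 0 < a) (haq : a < q) :
    ∃ C : ℝ, 0 < C ∧ ∀ (L : ℝ), 0 < L → ∀ g : Eucl N → ℝ, Measurable g → (∀ x, 0 ≤ g x) →
      ∫⁻ z : Eucl N × Eucl N, ENNReal.ofReal ((g z.1 + g z.2) * truncKernel a q L z) ≤
        ENNReal.ofReal (C * L ^ a) * ∫⁻ x, ENNReal.ofReal (g x) := by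
  obtain ⟨C, hC, h⟩ := exists_lintegral_truncated_kernel_le (N := N) hN ha haq
  refine ⟨2 * C, by positivity, fun L hL g hg hg0 => ?_⟩
  have e : ∀ z : Eucl N × Eucl N, ENNReal.ofReal ((g z.1 + g z.2) * truncKernel a q L z) =
      ENNReal.ofReal (g z.1) * ENNReal.ofReal (truncKernel a q L z) +
        ENNReal.ofReal (g z.2) * ENNReal.ofReal (truncKernel a q L z) := by
    intro z
    have := truncKernel_nonneg (a := a) (q := q) hL.le z
    rw [add_mul, ENNReal.ofReal_add (mul_nonneg (hg0 _) this) (mul_nonneg (hg0 _) this),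
      ENNReal.ofReal_mul (hg0 _), ENNReal.ofReal_mul (hg0 _)]
  simp only [e]
  rw [lintegral_add_left (by fun_prop)]
  have h1 := lintegral_fst_mul_le (g := fun x => ENNReal.ofReal (g x)) (by fun_prop)
    (κ := fun z => ENNReal.ofReal (truncKernel a q L z)) (by fun_prop) (fun x _ => h L hL x)
  have h2 := lintegral_snd_mul_le (g := fun x => ENNReal.ofReal (g x)) (by fun_prop)
    (κ := fun z => ENNReal.ofReal (truncKernel a q L z)) (by fun_prop)
    (K := ENNReal.ofReal (C * L ^ a)) (fun x _ => by
      refine le_trans (le_of_eq ?_) (h L hL x)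
      refine lintegral_congr fun y => ?_
      rw [truncKernel, norm_sub_rev])
  refine (add_le_add h1 h2).trans (le_of_eq ?_)
  rw [← mul_add, mul_comm, ← ENNReal.ofReal_add (by positivity) (by positivity)]
  congr 2; ring

end Product

/-- The weak equation enters as `∫ F = 0`. Integrability of `R` need not be assumed: if its integral
is infinite there is nothing to prove. -/
theorem lintegral_le_of_integral_eq_zero {α : Type*} [MeasurableSpace α] {μ : Measure α}
    {F G R : α → ℝ} (hF : Integrable F μ) (h0 : ∫ x, F x ∂μ = 0) (hR : AEStronglyMeasurable R μ)
    (hR0 : ∀ x, 0 ≤ R x) (hG0 : ∀ x, 0 ≤ G x) (h : ∀ᵐ x ∂μ, G x ≤ F x + R x) :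
    ∫⁻ x, ENNReal.ofReal (G x) ∂μ ≤ ∫⁻ x, ENNReal.ofReal (R x) ∂μ := by
  by_cases hfin : ∫⁻ x, ENNReal.ofReal (R x) ∂μ = ⊤
  · simp [hfin]
  have hRi : Integrable R μ := by
    refine ⟨hR, ?_⟩
    rw [hasFiniteIntegral_iff_ofReal (Filter.Eventually.of_forall hR0)]
    exact lt_top_iff_ne_top.2 hfin
  calc ∫⁻ x, ENNReal.ofReal (G x) ∂μ ≤ ∫⁻ x, ENNReal.ofReal (F x + R x) ∂μ :=
        lintegral_mono_ae (h.mono fun x hx => ENNReal.ofReal_le_ofReal hx)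
    _ = ENNReal.ofReal (∫ x, (F x + R x) ∂μ) :=
        (ofReal_integral_eq_lintegral_ofReal (hF.add hRi)
          (h.mono fun x hx => (hG0 x).trans hx)).symm
    _ = ENNReal.ofReal (∫ x, R x ∂μ) := by rw [integral_add hF hRi, h0, zero_add]
    _ = _ := ofReal_integral_eq_lintegral_ofReal hRi (Filter.Eventually.of_forall hR0)

/-! ### Truncated solutions as test functions -/

/-- The integrand of the Gagliardo seminorm. -/
noncomputable def diffQuot {N : ℕ} (a q : ℝ) (f : Eucl N → ℝ) (z : Eucl N × Eucl N) : ℝ :=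
  |f z.1 - f z.2| ^ q / ‖z.1 - z.2‖ ^ ((N : ℝ) + a)

theorem diffQuot_nonneg {N : ℕ} (a q : ℝ) (f : Eucl N → ℝ) (z : Eucl N × Eucl N) :
    0 ≤ diffQuot a q f z := by
  unfold diffQuot
  positivity

theorem measurable_diffQuot {N : ℕ} {a q : ℝ} {f : Eucl N → ℝ} (hf : Measurable f) :
    Measurable (diffQuot a q f) := by
  unfold diffQuot
  fun_prop

theorem gagliardo_univ {N : ℕ} (γ q : ℝ) (f : Eucl N → ℝ) :
    gagliardo γ q univ f = ∫⁻ z, ENNReal.ofReal (diffQuot (γ * q) q f z) := by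
  rw [gagliardo, univ_prod_univ, Measure.restrict_univ]
  rfl

theorem lintegral_indicator_diffQuot {N : ℕ} {γ q : ℝ} {f : Eucl N → ℝ} {B : Set (Eucl N)}
    (hB : MeasurableSet B) :
    ∫⁻ z, ENNReal.ofReal ((B ×ˢ B).indicator (diffQuot (γ * q) q f) z) = gagliardo γ q B f := by
  rw [gagliardo, ← lintegral_indicator (hB.prod hB)]
  refine lintegral_congr fun z => ?_
  by_cases hz : z ∈ B ×ˢ B
  · rw [indicator_of_mem hz, indicator_of_mem hz]; rfl
  · rw [indicator_of_notMem hz, indicator_of_notMem hz]; simp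

theorem lintegral_ofReal_indicator {α : Type*} [MeasurableSpace α] {μ : Measure α} {f : α → ℝ}
    {B : Set α} (hB : MeasurableSet B) :
    ∫⁻ x, ENNReal.ofReal (B.indicator f x) ∂μ = ∫⁻ x in B, ENNReal.ofReal (f x) ∂μ := by
  rw [← lintegral_indicator hB]
  refine lintegral_congr fun z => ?_
  by_cases hz : z ∈ B <;> simp [hz]

theorem MemFracSobolev.lintegral_rpow_lt_top {N : ℕ} {γ q : ℝ} {S : Set (Eucl N)} {u : Eucl N → ℝ}
    (hq : 0 < q) (h : MemFracSobolev γ q S u) :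
    ∫⁻ x in S, ENNReal.ofReal (|u x| ^ q) < ⊤ := by
  have := lintegral_rpow_enorm_lt_top_of_eLpNorm_lt_top (by simpa using hq) (by simp) h.1.2
  rw [ENNReal.toReal_ofReal hq.le] at this
  refine lt_of_le_of_lt (lintegral_mono fun x => ?_) this
  rw [← ENNReal.ofReal_rpow_of_nonneg (abs_nonneg _) hq.le, Real.enorm_eq_ofReal_abs]

theorem posPart_sub_le_abs {a k : ℝ} (hk : 0 ≤ k) : max (a - k) 0 ≤ |a| :=
  max_le (by have := le_abs_self a; linarith) (abs_nonneg _)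

theorem abs_posPart_sub_le (a b k : ℝ) : |max (a - k) 0 - max (b - k) 0| ≤ |a - b| := by
  have := abs_max_sub_max_le_max (a - k) 0 (b - k) 0
  simpa using this

theorem abs_posPart_mul_cutoff_le {N : ℕ} {B : Set (Eucl N)} {u ψ : Eucl N → ℝ} {k L : ℝ}
    (hk : 0 ≤ k) (hψ : IsCutoff B L ψ) (x : Eucl N) : |max (u x - k) 0 * ψ x| ≤ |u x| := by
  have hw0 : 0 ≤ max (u x - k) 0 := le_max_right _ _
  rw [abs_of_nonneg (mul_nonneg hw0 (hψ.mem_Icc x).1)]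
  exact (mul_le_of_le_one_right hw0 (hψ.mem_Icc x).2).trans (posPart_sub_le_abs hk)

theorem abs_posPart_mul_cutoff_sub_le {N : ℕ} {B : Set (Eucl N)} {u ψ : Eucl N → ℝ} {k L : ℝ}
    (hk : 0 ≤ k) (hψ : IsCutoff B L ψ) (x y : Eucl N) :
    |max (u x - k) 0 * ψ x - max (u y - k) 0 * ψ y| ≤
      |u x - u y| + |u y| * min 1 (L * ‖x - y‖) := by
  have e : max (u x - k) 0 * ψ x - max (u y - k) 0 * ψ y =
    (max (u x - k) 0 - max (u y - k) 0) * ψ x + max (u y - k) 0 * (ψ x - ψ y) := by ring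
  have hw0 : 0 ≤ max (u y - k) 0 := le_max_right _ _
  rw [e]
  refine (abs_add_le _ _).trans (add_le_add ?_ ?_)
  · rw [abs_mul, abs_of_nonneg (hψ.mem_Icc x).1]
    exact (mul_le_of_le_one_right (abs_nonneg _) (hψ.mem_Icc x).2).trans
      (abs_posPart_sub_le _ _ _)
  · rw [abs_mul, abs_of_nonneg hw0]
    exact mul_le_mul (posPart_sub_le_abs hk) (hψ.abs_sub_le x y) (abs_nonneg _) (abs_nonneg _)

/-- Inside `B ×ˢ B` this is the product rule. If exactly one point lies in `B`, the value at the
other vanishes and the gap condition supplies the full kernel. -/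
theorem diffQuot_posPart_mul_cutoff_le {N : ℕ} {a q : ℝ} (hq : 1 ≤ q) {B : Set (Eucl N)}
    {u ψ : Eucl N → ℝ} {k L : ℝ} (hk : 0 ≤ k) (hL : 0 < L) (hψ : IsCutoff B L ψ)
    (z : Eucl N × Eucl N) :
    diffQuot a q (fun x => max (u x - k) 0 * ψ x) z ≤
      2 ^ q * ((B ×ˢ B).indicator (diffQuot a q u) z +
        (B.indicator (fun x => |u x| ^ q) z.1 + B.indicator (fun x => |u x| ^ q) z.2) *
          truncKernel a q L z) := by
  obtain ⟨x, y⟩ := z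
  have hq0 : 0 ≤ q := by linarith
  have h2q : (1 : ℝ) ≤ 2 ^ q := Real.one_le_rpow (by norm_num) hq0
  have hT0 := fun z : Eucl N × Eucl N => truncKernel_nonneg (a := a) (q := q) hL.le z
  have hoff : ∀ x y : Eucl N, y ∉ B → |max (u x - k) 0 * ψ x| ^ q / ‖x - y‖ ^ ((N : ℝ) + a) ≤
      2 ^ q * (|u x| ^ q * truncKernel a q L (x, y)) := by
    intro x y hy
    have h0 : 0 ≤ |u x| ^ q * truncKernel a q L (x, y) := mul_nonneg (by positivity) (hT0 _)
    refine le_trans ?_ (le_mul_of_one_le_left h0 h2q)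
    rcases eq_or_ne (ψ x) 0 with h0 | h0
    · rw [h0, mul_zero, abs_zero, Real.zero_rpow (by linarith), zero_div]
      exact mul_nonneg (by positivity) (hT0 _)
    · rw [truncKernel_eq (z := (x, y)) (hψ.gap x y h0 hy), mul_one_div]
      have := Real.rpow_le_rpow (abs_nonneg _) (abs_posPart_mul_cutoff_le (u := u) hk hψ x) hq0
      gcongr
  by_cases hx : x ∈ B <;> by_cases hy : y ∈ B
  · simp only [indicator_of_mem (mk_mem_prod hx hy), indicator_of_mem hx,
      indicator_of_mem hy, diffQuot, truncKernel]
    rw [← mul_div_assoc, ← add_div, ← mul_div_assoc]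
    refine div_le_div_of_nonneg_right ?_ (by positivity)
    refine (Real.rpow_le_rpow (abs_nonneg _) (abs_posPart_mul_cutoff_sub_le hk hψ x y) hq0).trans ?_
    refine (add_rpow_le_two_rpow_mul hq0 (by positivity) (by positivity)).trans ?_
    rw [Real.mul_rpow (abs_nonneg _) (by positivity)]
    have : 0 ≤ |u x| ^ q * min 1 (L * ‖x - y‖) ^ q := by positivity
    refine mul_le_mul_of_nonneg_left ?_ (by positivity)
    linarith
  · have h3 : (x, y) ∉ B ×ˢ B := fun h => hy h.2
    simpa [diffQuot, indicator_of_notMem h3, hx, hy, hψ.eq_zero hy] using hoff x y hy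
  · have h3 : (x, y) ∉ B ×ˢ B := fun h => hx h.1
    have h1 := hoff y x hx
    rw [norm_sub_rev, ← truncKernel_swap, Prod.swap_prod_mk] at h1
    simpa [diffQuot, indicator_of_notMem h3, hx, hy, hψ.eq_zero hx] using h1
  · simp [diffQuot, hx, hy, hψ.eq_zero hx, hψ.eq_zero hy,
      Real.zero_rpow (by linarith : q ≠ 0)]

/-- Truncating a fractional Sobolev function and multiplying it by a cutoff function. -/
theorem MemFracSobolev.posPart_mul_cutoff {N : ℕ} (hN : 0 < N) {γ q : ℝ} (hγ : γ ∈ Ioo (0 : ℝ) 1)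
    (hq : 1 ≤ q) {B : Set (Eucl N)} (hB : MeasurableSet B) {u : Eucl N → ℝ} (hu : Measurable u)
    (h : MemFracSobolev γ q B u) {k : ℝ} (hk : 0 ≤ k) {L : ℝ} (hL : 0 < L) {ψ : Eucl N → ℝ}
    (hψ : IsCutoff B L ψ) : MemFracSobolev γ q univ (fun x => max (u x - k) 0 * ψ x) := by
  have hψm : Measurable ψ := (hψ.continuous hL.le).measurable
  constructor
  · rw [Measure.restrict_univ]
    have h1 : MemLp (B.indicator u) (ENNReal.ofReal q) volume :=
      (memLp_indicator_iff_restrict hB).2 h.1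
    refine h1.mono (by fun_prop) (Filter.Eventually.of_forall fun x => ?_)
    by_cases hx : x ∈ B
    · simpa [hx] using abs_posPart_mul_cutoff_le (u := u) hk hψ x
    · simp [hx, hψ.eq_zero hx]
  · obtain ⟨C, hC, hker⟩ := exists_lintegral_mul_truncKernel_le hN (a := γ * q) (q := q)
      (by have := hγ.1; positivity) (by nlinarith [hγ.2])
    rw [gagliardo_univ]
    refine lt_of_le_of_lt (lintegral_mono fun z => ENNReal.ofReal_le_ofReal
      (diffQuot_posPart_mul_cutoff_le hq hk hL hψ z)) ?_
    simp only [ENNReal.ofReal_mul (show (0 : ℝ) ≤ 2 ^ q by positivity)]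
    rw [lintegral_const_mul' _ _ ENNReal.ofReal_ne_top]
    refine ENNReal.mul_lt_top ENNReal.ofReal_lt_top ?_
    refine lt_of_le_of_lt (lintegral_mono fun z => ENNReal.ofReal_add_le) ?_
    rw [lintegral_add_left
      ((measurable_diffQuot hu).indicator (hB.prod hB)).ennreal_ofReal,
      lintegral_indicator_diffQuot hB]
    refine ENNReal.add_lt_top.2 ⟨h.2, lt_of_le_of_lt (hker L hL _ ?_ ?_)
      (ENNReal.mul_lt_top ENNReal.ofReal_lt_top ?_)⟩
    · exact Measurable.indicator (by fun_prop) hB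
    · exact fun x => indicator_nonneg (fun x _ => by positivity) x
    · rw [lintegral_ofReal_indicator hB]
      exact h.lintegral_rpow_lt_top (by linarith)

/-! ### The tail term and pointwise energy estimates -/

/-- The interaction of `f` inside `B` with `|u| ^ (p - 1)` outside `B`. -/
noncomputable def tailTerm {N : ℕ} (a p : ℝ) (B : Set (Eucl N)) (u f : Eucl N → ℝ)
    (z : Eucl N × Eucl N) : ℝ :=
  f z.1 * (Bᶜ.indicator (fun y => |u y| ^ (p - 1)) z.2 / ‖z.1 - z.2‖ ^ ((N : ℝ) + a))

section TailTerm

variable {N : ℕ} {a p : ℝ} {B : Set (Eucl N)} {u f : Eucl N → ℝ}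

theorem tailTerm_nonneg (hf : ∀ x, 0 ≤ f x) (z : Eucl N × Eucl N) : 0 ≤ tailTerm a p B u f z := by
  have : 0 ≤ Bᶜ.indicator (fun y => |u y| ^ (p - 1)) z.2 :=
    indicator_nonneg (fun x _ => by positivity) _
  have := hf z.1
  unfold tailTerm
  positivity

theorem measurable_tailTerm (hB : MeasurableSet B) (hu : Measurable u) (hf : Measurable f) :
    Measurable (tailTerm a p B u f) := by
  have : Measurable (Bᶜ.indicator (fun y => |u y| ^ (p - 1))) :=
    Measurable.indicator (by fun_prop) hB.compl
  unfold tailTerm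
  fun_prop

theorem lintegral_tailTerm_le (hB : MeasurableSet B) (hu : Measurable u) (hf : Measurable f)
    (hf0 : ∀ x, 0 ≤ f x) {τ : ENNReal}
    (hτ : ∀ x, f x ≠ 0 →
      ∫⁻ y in Bᶜ, ENNReal.ofReal (|u y| ^ (p - 1) / ‖x - y‖ ^ ((N : ℝ) + a)) ≤ τ) :
    ∫⁻ z, ENNReal.ofReal (tailTerm a p B u f z) ≤ (∫⁻ x, ENNReal.ofReal (f x)) * τ := by
  have hm : Measurable (Bᶜ.indicator (fun y => |u y| ^ (p - 1))) :=
    Measurable.indicator (by fun_prop) hB.compl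
  have h := lintegral_fst_mul_le (g := fun x => ENNReal.ofReal (f x)) (by fun_prop)
    (κ := fun z => ENNReal.ofReal
      (Bᶜ.indicator (fun y => |u y| ^ (p - 1)) z.2 / ‖z.1 - z.2‖ ^ ((N : ℝ) + a)))
    (by fun_prop) (K := τ) (fun x hx => by
      refine le_trans (le_of_eq ?_) (hτ x (fun h => hx (by simp [h])))
      rw [← lintegral_indicator hB.compl]
      refine lintegral_congr fun y => ?_
      by_cases hy : y ∈ Bᶜ
      · rw [indicator_of_mem hy, indicator_of_mem hy]
      · rw [indicator_of_notMem hy, indicator_of_notMem hy]; simp)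
  refine le_trans (le_of_eq (lintegral_congr fun z => ?_)) h
  rw [tailTerm, ENNReal.ofReal_mul (hf0 _)]

theorem lintegral_tailTerm_add_swap_le (hB : MeasurableSet B) (hu : Measurable u)
    (hf : Measurable f) (hf0 : ∀ x, 0 ≤ f x) {τ : ENNReal}
    (hτ : ∀ x, f x ≠ 0 →
      ∫⁻ y in Bᶜ, ENNReal.ofReal (|u y| ^ (p - 1) / ‖x - y‖ ^ ((N : ℝ) + a)) ≤ τ) :
    ∫⁻ z, ENNReal.ofReal (tailTerm a p B u f z + tailTerm a p B u f z.swap) ≤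
      2 * ((∫⁻ x, ENNReal.ofReal (f x)) * τ) := by
  have h := lintegral_tailTerm_le hB hu hf hf0 hτ
  have hm : Measurable (tailTerm a p B u f) := measurable_tailTerm hB hu hf
  refine (lintegral_mono fun z => ENNReal.ofReal_add_le).trans ?_
  rw [lintegral_add_left hm.ennreal_ofReal, two_mul]
  refine add_le_add h ?_
  rw [Measure.volume_eq_prod, lintegral_prod_swap (fun z => ENNReal.ofReal (tailTerm a p B u f z)),
    ← Measure.volume_eq_prod]
  exact h

end TailTerm

/-- On `B ×ˢ B` apply `abs_sub_le_sgn_mul`. Across the boundary of `B` the bound `|Z| ≤ 1` suffices,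
at the cost of twice the truncation; hence this operator contributes no tail. -/
theorem diffQuot_one_le_sgn_mul {N : ℕ} {a : ℝ} {B : Set (Eucl N)} {u ψ : Eucl N → ℝ} {k L : ℝ}
    (hL : 0 < L) (hψ : IsCutoff B L ψ) {z : Eucl N × Eucl N} {Z : ℝ}
    (hZ : Z ∈ sgnSet (u z.1 - u z.2)) :
    diffQuot a 1 (fun x => max (u x - k) 0 * ψ x) z ≤
      Z * (max (u z.1 - k) 0 * ψ z.1 - max (u z.2 - k) 0 * ψ z.2) / ‖z.1 - z.2‖ ^ ((N : ℝ) + a) +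
      2 * ((B.indicator (fun x => max (u x - k) 0) z.1 +
        B.indicator (fun x => max (u x - k) 0) z.2) * truncKernel a 1 L z) := by
  obtain ⟨x, y⟩ := z
  have hw0 : ∀ x, 0 ≤ max (u x - k) 0 := fun x => le_max_right _ _
  have hT0 := fun x y : Eucl N => truncKernel_nonneg (a := a) (q := 1) hL.le (x, y)
  have hZ1 := abs_le_one_of_mem_sgnSet hZ
  have hoff : ∀ (x y : Eucl N) (Z : ℝ), y ∉ B → |Z| ≤ 1 →
      |max (u x - k) 0 * ψ x| / ‖x - y‖ ^ ((N : ℝ) + a) ≤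
      Z * (max (u x - k) 0 * ψ x) / ‖x - y‖ ^ ((N : ℝ) + a) +
        2 * (max (u x - k) 0 * truncKernel a 1 L (x, y)) := by
    intro x y Z hy hZ
    rcases eq_or_ne (ψ x) 0 with h0 | h0
    · simp only [h0, mul_zero, abs_zero, zero_div, zero_add]
      have := mul_nonneg (hw0 x) (hT0 x y)
      linarith
    · rw [truncKernel_eq (z := (x, y)) (hψ.gap x y h0 hy), mul_one_div, ← mul_div_assoc, ← add_div]
      refine div_le_div_of_nonneg_right ?_ (by positivity)
      have h1 := (hψ.mem_Icc x).1
      have h2 := mul_le_of_le_one_right (hw0 x) (hψ.mem_Icc x).2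
      have h3 := mul_nonneg (hw0 x) h1
      rw [abs_of_nonneg h3]
      nlinarith [(abs_le.1 hZ).1]
  by_cases hx : x ∈ B <;> by_cases hy : y ∈ B
  · simp only [indicator_of_mem hx, indicator_of_mem hy, diffQuot, truncKernel, Real.rpow_one]
    rw [← mul_div_assoc, ← mul_div_assoc, ← add_div]
    refine div_le_div_of_nonneg_right ?_ (by positivity)
    refine (abs_sub_le_sgn_mul hZ (hψ.mem_Icc x).1 (hψ.mem_Icc y).1).trans ?_
    have := mul_le_mul_of_nonneg_left (hψ.abs_sub_le x y) (add_nonneg (hw0 x) (hw0 y))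
    linarith
  · simpa [diffQuot, hx, hy, hψ.eq_zero hy] using hoff x y Z hy hZ1
  · have h1 := hoff y x (-Z) hx (by simpa using hZ1)
    rw [norm_sub_rev, ← truncKernel_swap, Prod.swap_prod_mk] at h1
    simpa [diffQuot, hx, hy, hψ.eq_zero hx] using h1
  · simp [diffQuot, hx, hy, hψ.eq_zero hx, hψ.eq_zero hy]

/-- Here `caccioppoli_pointwise` handles `B ×ˢ B`, and `neg_tail_le` handles pairs with one point
outside `B`, which is where the tail enters. -/
theorem exists_diffQuot_le_mul_add {N : ℕ} {a p : ℝ} (hp : 1 < p) :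
    ∃ C : ℝ, 0 < C ∧ ∀ {B : Set (Eucl N)} {u ψ : Eucl N → ℝ} {k L : ℝ},
    0 ≤ k → 0 < L → IsCutoff B L ψ → ∀ z : Eucl N × Eucl N,
    diffQuot a p (fun x => max (u x - k) 0 * ψ x) z ≤
      2 ^ p * 2 * (|u z.1 - u z.2| ^ (p - 2) * (u z.1 - u z.2) *
        (max (u z.1 - k) 0 * ψ z.1 ^ p - max (u z.2 - k) 0 * ψ z.2 ^ p) /
          ‖z.1 - z.2‖ ^ ((N : ℝ) + a)) +
      C * ((B.indicator (fun x => max (u x - k) 0 ^ p) z.1 +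
        B.indicator (fun x => max (u x - k) 0 ^ p) z.2) * truncKernel a p L z +
        (tailTerm a p B u (fun x => max (u x - k) 0 * ψ x ^ p) z +
          tailTerm a p B u (fun x => max (u x - k) 0 * ψ x ^ p) z.swap)) := by
  set D : ℝ := 2 * (2 ^ (p - 1) * p ^ p) + 1 with hD
  have hD1 : 1 ≤ D := by
    have : 0 ≤ 2 * (2 ^ (p - 1) * p ^ p) := by positivity
    linarith
  have h2p : (1 : ℝ) ≤ 2 ^ p := Real.one_le_rpow (by norm_num) (by linarith)
  -- One constant dominates three: `2 ^ p * D * 2 ^ p` inside `B ×ˢ B`, 1 for the kernel term across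
  -- the boundary, and `2 ^ p * 2` for the tail.
  refine ⟨2 ^ p * 2 * D * 2 ^ p, by positivity, ?_⟩
  intro B u ψ k L hk hL hψ z
  obtain ⟨x, y⟩ := z
  have hC1 : 1 ≤ 2 ^ p * 2 * D * 2 ^ p := by
    have : (1 : ℝ) ≤ 2 ^ p * 2 := by linarith
    exact one_le_mul_of_one_le_of_one_le (one_le_mul_of_one_le_of_one_le this hD1) h2p
  have hC2 : 2 ^ p * 2 ≤ 2 ^ p * 2 * D * 2 ^ p := by
    rw [mul_assoc (2 ^ p * 2)]
    exact le_mul_of_one_le_right (by positivity) (one_le_mul_of_one_le_of_one_le hD1 h2p)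
  have hw0 : ∀ x, 0 ≤ max (u x - k) 0 := fun x => le_max_right _ _
  have hψ0 : ∀ x, 0 ≤ ψ x := fun x => (hψ.mem_Icc x).1
  have hT0 := fun x y : Eucl N => truncKernel_nonneg (a := a) (q := p) hL.le (x, y)
  have hp0 : p ≠ 0 := by linarith
  have hoff : ∀ (x y : Eucl N), y ∉ B →
      |max (u x - k) 0 * ψ x| ^ p / ‖x - y‖ ^ ((N : ℝ) + a) ≤
      2 ^ p * 2 * (|u x - u y| ^ (p - 2) * (u x - u y) * (max (u x - k) 0 * ψ x ^ p) /
          ‖x - y‖ ^ ((N : ℝ) + a)) +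
      2 ^ p * 2 * D * 2 ^ p * (max (u x - k) 0 ^ p * truncKernel a p L (x, y) +
        tailTerm a p B u (fun x => max (u x - k) 0 * ψ x ^ p) (x, y)) := by
    intro x y hy
    simp only [tailTerm]
    have hyc : y ∈ Bᶜ := hy
    rw [indicator_of_mem hyc]
    rcases eq_or_ne (ψ x) 0 with h0 | h0
    · simp only [h0, mul_zero, abs_zero, Real.zero_rpow hp0, zero_div, zero_add, zero_mul, add_zero]
      exact mul_nonneg (by linarith) (mul_nonneg (Real.rpow_nonneg (hw0 x) _) (hT0 x y))
    · rw [truncKernel_eq (z := (x, y)) (hψ.gap x y h0 hy), mul_one_div, ← mul_div_assoc,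
        ← mul_div_assoc, ← add_div, ← mul_div_assoc, ← add_div]
      refine div_le_div_of_nonneg_right ?_ (by positivity)
      have h1 : |max (u x - k) 0 * ψ x| ^ p ≤ max (u x - k) 0 ^ p := by
        refine Real.rpow_le_rpow (abs_nonneg _) ?_ (by linarith)
        rw [abs_of_nonneg (mul_nonneg (hw0 x) (hψ0 x))]
        exact mul_le_of_le_one_right (hw0 x) (hψ.mem_Icc x).2
      have h2 := neg_tail_le (a := u x) (b := u y) hp hk (Real.rpow_nonneg (hψ0 x) p)
      have h3 : 0 ≤ max (u x - k) 0 ^ p := Real.rpow_nonneg (hw0 x) _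
      have h4 : 0 ≤ |u y| ^ (p - 1) * (max (u x - k) 0 * ψ x ^ p) := by
        have := hw0 x
        have := hψ0 x
        positivity
      have h5 := mul_le_mul_of_nonneg_right hC1 h3
      have h6 := mul_le_mul_of_nonneg_right hC2 h4
      have h7 := mul_nonneg (by positivity : (0 : ℝ) ≤ 2 ^ p * 2) h2
      linarith
  by_cases hx : x ∈ B <;> by_cases hy : y ∈ B
  · have hxc : x ∉ Bᶜ := fun h => h hx
    have hyc : y ∉ Bᶜ := fun h => h hy
    simp only [indicator_of_mem hx, indicator_of_mem hy, diffQuot, truncKernel, tailTerm,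
      Prod.swap_prod_mk, indicator_of_notMem hxc, indicator_of_notMem hyc, zero_div, mul_zero,
      add_zero]
    rw [← mul_div_assoc, ← mul_div_assoc, ← mul_div_assoc, ← add_div]
    refine div_le_div_of_nonneg_right ?_ (by positivity)
    refine (caccioppoli_pointwise hp (hψ0 x) (hψ0 y)).trans ?_
    rw [mul_add, ← mul_assoc (2 ^ p) 2]
    refine add_le_add le_rfl ?_
    have h1 := add_rpow_le_two_rpow_mul (q := p) (by linarith) (hw0 x) (hw0 y)
    have h2 : |ψ x - ψ y| ^ p ≤ (min 1 (L * ‖x - y‖)) ^ p :=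
      Real.rpow_le_rpow (abs_nonneg _) (hψ.abs_sub_le x y) (by linarith)
    have h3 : 0 ≤ max (u x - k) 0 ^ p := Real.rpow_nonneg (hw0 x) _
    have h4 : 0 ≤ max (u y - k) 0 ^ p := Real.rpow_nonneg (hw0 y) _
    have h5 := mul_le_mul h1 h2 (by positivity) (by positivity)
    have h6 : 0 ≤ 2 ^ p * (max (u x - k) 0 ^ p + max (u y - k) 0 ^ p) *
      (min 1 (L * ‖x - y‖)) ^ p := by positivity
    have h7 : 2 ^ p * D * ((max (u x - k) 0 + max (u y - k) 0) ^ p * |ψ x - ψ y| ^ p) ≤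
        2 ^ p * D * (2 ^ p * (max (u x - k) 0 ^ p + max (u y - k) 0 ^ p) *
          (min 1 (L * ‖x - y‖)) ^ p) := mul_le_mul_of_nonneg_left h5 (by positivity)
    have h8 := mul_nonneg (by positivity : 0 ≤ 2 ^ p * D) h6
    linarith
  · have hxc : x ∉ Bᶜ := fun h => h hx
    have h1 := hoff x y hy
    have h2 : tailTerm a p B u (fun x => max (u x - k) 0 * ψ x ^ p) (y, x) = 0 := by
      simp [tailTerm, hx]
    simp only [diffQuot, indicator_of_mem hx, indicator_of_notMem hy, hψ.eq_zero hy, mul_zero,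
      sub_zero, Real.zero_rpow hp0, add_zero, Prod.swap_prod_mk, h2]
    exact h1
  · have hyc : y ∉ Bᶜ := fun h => h hy
    have h1 := hoff y x hx
    have h2 : tailTerm a p B u (fun x => max (u x - k) 0 * ψ x ^ p) (x, y) = 0 := by
      simp [tailTerm, hy]
    rw [norm_sub_rev, ← truncKernel_swap, Prod.swap_prod_mk, abs_sub_comm (u y)] at h1
    simp only [diffQuot, indicator_of_mem hy, indicator_of_notMem hx, hψ.eq_zero hx, mul_zero,
      zero_sub, abs_neg, Real.zero_rpow hp0, zero_add, Prod.swap_prod_mk, h2]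
    refine h1.trans (le_of_eq ?_)
    ring
  · simp [diffQuot, tailTerm, hx, hy, hψ.eq_zero hx, hψ.eq_zero hy, Real.zero_rpow hp0]

/-- A majorant that makes the `p`-integrand of the weak formulation integrable, so that its Bochner
integral can be added to others and compared pointwise. -/
theorem abs_mul_posPart_cutoff_le {N : ℕ} {a p : ℝ} (hp : 1 < p) {B : Set (Eucl N)}
    {u ψ : Eucl N → ℝ} {k L : ℝ} (hk : 0 ≤ k) (hL : 0 < L) (hψ : IsCutoff B L ψ)
    (z : Eucl N × Eucl N) :
    |(|u z.1 - u z.2| ^ (p - 2) * (u z.1 - u z.2) *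
        (max (u z.1 - k) 0 * ψ z.1 - max (u z.2 - k) 0 * ψ z.2) /
          ‖z.1 - z.2‖ ^ ((N : ℝ) + a))| ≤
      (B ×ˢ B).indicator (diffQuot a p u) z + diffQuot a p (fun x => max (u x - k) 0 * ψ x) z +
      2 ^ (p - 1) * ((B.indicator (fun x => |u x| ^ p) z.1 +
        B.indicator (fun x => |u x| ^ p) z.2) * truncKernel a p L z +
        (tailTerm a p B u (fun x => max (u x - k) 0 * ψ x) z +
          tailTerm a p B u (fun x => max (u x - k) 0 * ψ x) z.swap)) := by
  obtain ⟨x, y⟩ := z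
  have hw0 : ∀ x, 0 ≤ max (u x - k) 0 := fun x => le_max_right _ _
  have hψ0 : ∀ x, 0 ≤ ψ x := fun x => (hψ.mem_Icc x).1
  have hφ0 : ∀ x, 0 ≤ max (u x - k) 0 * ψ x := fun x => mul_nonneg (hw0 x) (hψ0 x)
  have hT0 := fun x y : Eucl N => truncKernel_nonneg (a := a) (q := p) hL.le (x, y)
  have htail := fun z => tailTerm_nonneg (a := a) (p := p) (B := B) (u := u) hφ0 z
  have hp0 : p ≠ 0 := by linarith
  have hn : ∀ x y : Eucl N, 0 ≤ ‖x - y‖ ^ ((N : ℝ) + a) := fun x y => by positivity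
  have hoff : ∀ (x y : Eucl N), y ∉ B →
      |u x - u y| ^ (p - 1) * (max (u x - k) 0 * ψ x) / ‖x - y‖ ^ ((N : ℝ) + a) ≤
      2 ^ (p - 1) * (|u x| ^ p * truncKernel a p L (x, y) +
        tailTerm a p B u (fun x => max (u x - k) 0 * ψ x) (x, y)) := by
    intro x y hy
    simp only [tailTerm]
    have hyc : y ∈ Bᶜ := hy
    rw [indicator_of_mem hyc]
    rcases eq_or_ne (ψ x) 0 with h0 | h0
    · simp only [h0, mul_zero, zero_div, zero_mul, add_zero]
      exact mul_nonneg (by positivity) (mul_nonneg (by positivity) (hT0 x y))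
    · rw [truncKernel_eq (z := (x, y)) (hψ.gap x y h0 hy), mul_one_div, ← mul_div_assoc,
        ← add_div, ← mul_div_assoc]
      refine div_le_div_of_nonneg_right ?_ (by positivity)
      have h1 : |u x - u y| ^ (p - 1) ≤ 2 ^ (p - 1) * (|u x| ^ (p - 1) + |u y| ^ (p - 1)) :=
        (Real.rpow_le_rpow (abs_nonneg _) (abs_sub _ _) (by linarith)).trans
          (add_rpow_le_two_rpow_mul (by linarith) (abs_nonneg _) (abs_nonneg _))
      have h2 : |u x| ^ (p - 1) * (max (u x - k) 0 * ψ x) ≤ |u x| ^ p := by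
        rw [← rpow_sub_one_mul_self hp (abs_nonneg _)]
        refine mul_le_mul_of_nonneg_left ?_ (by positivity)
        exact (le_abs_self _).trans (abs_posPart_mul_cutoff_le hk hψ x)
      have h3 := mul_le_mul_of_nonneg_right h1 (hφ0 x)
      have h4 := mul_le_mul_of_nonneg_left h2 (by positivity : (0 : ℝ) ≤ 2 ^ (p - 1))
      linarith
  rw [abs_div, abs_mul, abs_rpow_mul_self_eq hp, abs_of_nonneg (hn x y)]
  have hd0 := diffQuot_nonneg a p (fun x => max (u x - k) 0 * ψ x) (x, y)
  by_cases hx : x ∈ B <;> by_cases hy : y ∈ B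
  · rw [indicator_of_mem (mk_mem_prod hx hy)]
    refine le_add_of_le_of_nonneg ?_ ?_
    · simp only [diffQuot]
      rw [← add_div]
      refine div_le_div_of_nonneg_right ?_ (by positivity)
      exact rpow_sub_one_mul_le_add hp (abs_nonneg _) (abs_nonneg _)
    · have h1 : ∀ x, 0 ≤ B.indicator (fun x => |u x| ^ p) x :=
        fun x => indicator_nonneg (fun x _ => by positivity) x
      exact mul_nonneg (by positivity) (add_nonneg (mul_nonneg (add_nonneg (h1 _) (h1 _)) (hT0 x y))
        (add_nonneg (htail _) (htail _)))
  · have h1 := hoff x y hy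
    have h2 : tailTerm a p B u (fun x => max (u x - k) 0 * ψ x) (y, x) = 0 := by
      simp [tailTerm, hx]
    have h3 : (x, y) ∉ B ×ˢ B := fun h => hy h.2
    rw [indicator_of_notMem h3]
    simp only [indicator_of_mem hx, indicator_of_notMem hy, hψ.eq_zero hy, mul_zero,
      sub_zero, add_zero, Prod.swap_prod_mk, h2, abs_of_nonneg (hφ0 x)]
    linarith
  · have h1 := hoff y x hx
    have h2 : tailTerm a p B u (fun x => max (u x - k) 0 * ψ x) (x, y) = 0 := by
      simp [tailTerm, hy]
    have h3 : (x, y) ∉ B ×ˢ B := fun h => hx h.1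
    rw [norm_sub_rev, ← truncKernel_swap, Prod.swap_prod_mk, abs_sub_comm (u y)] at h1
    rw [indicator_of_notMem h3]
    simp only [indicator_of_mem hy, indicator_of_notMem hx, hψ.eq_zero hx, mul_zero,
      zero_sub, abs_neg, zero_add, Prod.swap_prod_mk, h2, abs_of_nonneg (hφ0 y)]
    linarith
  · simp [diffQuot, tailTerm, hx, hy, hψ.eq_zero hx, hψ.eq_zero hy, Real.zero_rpow hp0]

theorem integrable_of_lintegral_ofReal_lt_top {α : Type*} [MeasurableSpace α] {μ : Measure α}
    {f : α → ℝ} (hf : Measurable f) (hf0 : ∀ x, 0 ≤ f x)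
    (h : ∫⁻ x, ENNReal.ofReal (f x) ∂μ < ⊤) : Integrable f μ :=
  ⟨hf.aestronglyMeasurable, by
    rwa [hasFiniteIntegral_iff_ofReal (Filter.Eventually.of_forall hf0)]⟩

/-! ### The Caccioppoli inequality -/

section Caccioppoli

variable {N : ℕ} {p s₁ sp : ℝ}

theorem integrable_sgn_mul {s₁ : ℝ} {φ : Eucl N → ℝ} (hφm : Measurable φ)
    (hφ : gagliardo s₁ 1 univ φ < ⊤) {Z : Eucl N × Eucl N → ℝ} (hZm : AEStronglyMeasurable Z volume)
    (hZ : ∀ᵐ z, |Z z| ≤ 1) :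
    Integrable (fun z : Eucl N × Eucl N =>
      Z z * (φ z.1 - φ z.2) / ‖z.1 - z.2‖ ^ ((N : ℝ) + s₁)) volume := by
  have hdm := measurable_diffQuot (a := s₁) (q := 1) hφm
  rw [gagliardo_univ, mul_one] at hφ
  refine (integrable_of_lintegral_ofReal_lt_top hdm (diffQuot_nonneg _ _ _) hφ).mono' ?_ ?_
  · have h1 : Measurable fun z : Eucl N × Eucl N => (φ z.1 - φ z.2) := by fun_prop
    have h2 : Measurable fun z : Eucl N × Eucl N => (‖z.1 - z.2‖ ^ ((N : ℝ) + s₁)) := by fun_prop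
    exact ((hZm.aemeasurable.mul h1.aemeasurable).div h2.aemeasurable).aestronglyMeasurable
  · filter_upwards [hZ] with z hz
    rw [Real.norm_eq_abs, abs_div, abs_mul, abs_of_nonneg (by positivity : 0 ≤ ‖z.1 - z.2‖ ^ ((N : ℝ) + s₁)),
      diffQuot, Real.rpow_one]
    refine div_le_div_of_nonneg_right ?_ (by positivity)
    exact mul_le_of_le_one_left (abs_nonneg _) hz

/-- Each term of the majorant `abs_mul_posPart_cutoff_le` has finite integral. The order-one
hypothesis makes the test function integrable, as the tail term requires. -/
theorem integrable_p_term (hN : 0 < N) (hp : 1 < p) (hsp : sp ∈ Ioo (0 : ℝ) 1) {B : Set (Eucl N)}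
    (hB : MeasurableSet B) {u : Eucl N → ℝ} (hu : Measurable u)
    (hup : MemFracSobolev sp p B u) (hu1 : MemFracSobolev s₁ 1 B u) {L : ℝ} (hL : 0 < L)
    {ψ : Eucl N → ℝ} (hψ : IsCutoff B L ψ) {k : ℝ} (hk : 0 ≤ k) {τ : ℝ}
    (hτ : ∀ x, ψ x ≠ 0 →
      ∫⁻ y in Bᶜ, ENNReal.ofReal (|u y| ^ (p - 1) / ‖x - y‖ ^ ((N : ℝ) + sp * p)) ≤
        ENNReal.ofReal τ) :
    Integrable (fun z : Eucl N × Eucl N => |u z.1 - u z.2| ^ (p - 2) * (u z.1 - u z.2) *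
        (max (u z.1 - k) 0 * ψ z.1 - max (u z.2 - k) 0 * ψ z.2) /
          ‖z.1 - z.2‖ ^ ((N : ℝ) + sp * p)) volume := by
  have hψm : Measurable ψ := (hψ.continuous hL.le).measurable
  have hφm : Measurable fun x => max (u x - k) 0 * ψ x := by fun_prop
  have hφ0 : ∀ x, 0 ≤ max (u x - k) 0 * ψ x :=
    fun x => mul_nonneg (le_max_right _ _) (hψ.mem_Icc x).1
  have hBB : Measurable ((B ×ˢ B).indicator (diffQuot (sp * p) p u)) :=
    (measurable_diffQuot hu).indicator (hB.prod hB)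
  have i1 : Integrable ((B ×ˢ B).indicator (diffQuot (sp * p) p u)) volume :=
    integrable_of_lintegral_ofReal_lt_top hBB
      (fun z => indicator_nonneg (fun z _ => diffQuot_nonneg _ _ _ z) z)
      (by rw [lintegral_indicator_diffQuot hB]; exact hup.2)
  have i2 : Integrable (diffQuot (sp * p) p fun x => max (u x - k) 0 * ψ x) volume :=
    integrable_of_lintegral_ofReal_lt_top (measurable_diffQuot hφm) (diffQuot_nonneg _ _ _)
      (by
        rw [← gagliardo_univ]
        exact (hup.posPart_mul_cutoff hN hsp hp.le hB hu hk hL hψ).2)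
  obtain ⟨C, hC, hker⟩ := exists_lintegral_mul_truncKernel_le hN (a := sp * p) (q := p)
    (by have := hsp.1; positivity) (by nlinarith [hsp.2])
  have hgm : Measurable (B.indicator fun x => |u x| ^ p) := Measurable.indicator (by fun_prop) hB
  have hg0 : ∀ x, 0 ≤ B.indicator (fun x => |u x| ^ p) x :=
    fun x => indicator_nonneg (fun x _ => by positivity) x
  have i3 : Integrable (fun z : Eucl N × Eucl N => (B.indicator (fun x => |u x| ^ p) z.1 +
        B.indicator (fun x => |u x| ^ p) z.2) * truncKernel (sp * p) p L z) volume := by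
    refine integrable_of_lintegral_ofReal_lt_top ?_ ?_ ?_
    · exact ((hgm.comp measurable_fst).add (hgm.comp measurable_snd)).mul measurable_truncKernel
    · exact fun z => mul_nonneg (add_nonneg (hg0 _) (hg0 _)) (truncKernel_nonneg hL.le z)
    · refine lt_of_le_of_lt (hker L hL _ hgm hg0)
        (ENNReal.mul_lt_top ENNReal.ofReal_lt_top ?_)
      rw [lintegral_ofReal_indicator hB]
      exact hup.lintegral_rpow_lt_top (by linarith)
  have hφ1 : ∫⁻ x, ENNReal.ofReal (max (u x - k) 0 * ψ x) < ⊤ := by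
    have h1 := hu1.lintegral_rpow_lt_top one_pos
    rw [← lintegral_ofReal_indicator hB] at h1
    refine lt_of_le_of_lt (lintegral_mono fun x => ENNReal.ofReal_le_ofReal ?_) h1
    by_cases hx : x ∈ B
    · rw [indicator_of_mem hx, Real.rpow_one]
      exact (le_abs_self _).trans (abs_posPart_mul_cutoff_le hk hψ x)
    · simp [hx, hψ.eq_zero hx]
  have htm := measurable_tailTerm (a := sp * p) (p := p) hB hu hφm
  have i4 : Integrable (fun z => tailTerm (sp * p) p B u (fun x => max (u x - k) 0 * ψ x) z +
      tailTerm (sp * p) p B u (fun x => max (u x - k) 0 * ψ x) z.swap) volume := by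
    refine integrable_of_lintegral_ofReal_lt_top ?_ ?_ ?_
    · exact htm.add (htm.comp measurable_swap)
    · exact fun z => add_nonneg (tailTerm_nonneg hφ0 _) (tailTerm_nonneg hφ0 _)
    · refine lt_of_le_of_lt (lintegral_tailTerm_add_swap_le hB hu hφm hφ0 fun x hx => hτ x ?_)
        (ENNReal.mul_lt_top (by simp) (ENNReal.mul_lt_top hφ1 ENNReal.ofReal_lt_top))
      exact right_ne_zero_of_mul hx
  refine ((i1.add i2).add ((i3.add i4).const_mul (2 ^ (p - 1)))).mono' ?_
    (Filter.Eventually.of_forall fun z => abs_mul_posPart_cutoff_le hp hk hL hψ z)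
  exact Measurable.aestronglyMeasurable (by fun_prop)

/-- The Caccioppoli inequality for the truncations of a weak solution. -/
theorem exists_caccioppoli (hN : 0 < N) (hp : 1 < p) (hs₁ : s₁ ∈ Ioo (0 : ℝ) 1)
    (hsp : sp ∈ Ioo (0 : ℝ) 1) : ∃ C : ℝ, 0 < C ∧ ∀ (Ω : Set (Eucl N)) (u : Eucl N → ℝ),
    Measurable u → IsWeakSolution p s₁ sp Ω u → ∀ (B : Set (Eucl N)) (L : ℝ) (ψ : Eucl N → ℝ)
    (k τ : ℝ), IsOpen B → IsCompact (closure B) → closure B ⊆ Ω → 0 < L → IsCutoff B L ψ →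
    0 ≤ k → 0 ≤ τ → (∀ x, ψ x ≠ 0 →
      ∫⁻ y in Bᶜ, ENNReal.ofReal (|u y| ^ (p - 1) / ‖x - y‖ ^ ((N : ℝ) + sp * p)) ≤
        ENNReal.ofReal τ) →
    gagliardo s₁ 1 univ (fun x => max (u x - k) 0 * ψ x ^ p) +
      gagliardo sp p univ (fun x => max (u x - k) 0 * ψ x) ≤
    ENNReal.ofReal (C * (L ^ s₁ + τ)) * (∫⁻ x in B, ENNReal.ofReal (max (u x - k) 0)) +
      ENNReal.ofReal (C * L ^ (sp * p)) * ∫⁻ x in B, ENNReal.ofReal (max (u x - k) 0 ^ p) := by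
  obtain ⟨C₁, hC₁, hker₁⟩ := exists_lintegral_mul_truncKernel_le hN (a := s₁) (q := 1) hs₁.1 hs₁.2
  obtain ⟨C₂, hC₂, hker₂⟩ := exists_lintegral_mul_truncKernel_le hN (a := sp * p) (q := p)
    (by have := hsp.1; positivity) (by nlinarith [hsp.2])
  obtain ⟨C₃, hC₃, hpt⟩ := exists_diffQuot_le_mul_add (N := N) (a := sp * p) hp
  -- The `p`-estimate carries this factor in front of the equation, so the whole equation is
  -- multiplied by `c`. The order-one estimate tolerates it because its right side is nonnegative
  -- and `1 ≤ c`.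
  set c : ℝ := 2 ^ p * 2 with hc
  have hc0 : 0 < c := by positivity
  have hc1 : 1 ≤ c := by
    have : (1 : ℝ) ≤ 2 ^ p := Real.one_le_rpow (by norm_num) (by linarith)
    linarith
  refine ⟨c * 2 * (C₁ * p ^ s₁) + C₃ * C₂ + C₃ * 2, by positivity, ?_⟩
  intro Ω u hu hsol B L ψ k τ hBo hBc hBΩ hL hψ hk hτ0 hτ
  obtain ⟨hu1, hup, -, Z, hZm, hZs, heq⟩ := hsol
  replace hu1 := hu1 B hBo hBc hBΩ
  replace hup := hup B hBo hBc hBΩ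
  have hB := hBo.measurableSet
  have hΨ : IsCutoff B (p * L) (fun x => ψ x ^ p) := hψ.rpow hp.le
  have hpL : 0 < p * L := by positivity
  have hψm : Measurable ψ := (hψ.continuous hL.le).measurable
  have hφm : Measurable fun x => max (u x - k) 0 * ψ x ^ p := by fun_prop
  have hw0 : ∀ x, 0 ≤ max (u x - k) 0 := fun x => le_max_right _ _
  have hφ0 : ∀ x, 0 ≤ max (u x - k) 0 * ψ x ^ p := fun x => mul_nonneg (hw0 x) (hΨ.mem_Icc x).1
  have hp0 : p ≠ 0 := by linarith
  have hτ' : ∀ x, ψ x ^ p ≠ 0 → ψ x ≠ 0 := fun x hx h => hx (by rw [h, Real.zero_rpow hp0])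
  have hφ1 := hu1.posPart_mul_cutoff hN hs₁ le_rfl hB hu hk hpL hΨ
  have hφp := hup.posPart_mul_cutoff hN hsp hp.le hB hu hk hpL hΨ
  have hsupp : tsupport (fun x => max (u x - k) 0 * ψ x ^ p) ⊆ closure B := by
    refine closure_mono fun x hx => ?_
    by_contra h
    exact hx (by simp [hψ.eq_zero h, Real.zero_rpow hp0])
  have heq := heq _ hφ1 hφp (hBc.of_isClosed_subset (isClosed_tsupport _) hsupp)
    (hsupp.trans hBΩ)
  have iF1 := integrable_sgn_mul (s₁ := s₁) hφm hφ1.2 hZm.1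
    (hZs.mono fun z hz => abs_le_one_of_mem_sgnSet hz)
  have iF2 := integrable_p_term hN hp hsp hB hu hup hu1 hpL hΨ hk (fun x hx => hτ x (hτ' x hx))
  have i0 := (iF1.add iF2).const_mul c
  have h0 : ∫ z, c * (Z z * (max (u z.1 - k) 0 * ψ z.1 ^ p - max (u z.2 - k) 0 * ψ z.2 ^ p) /
      ‖z.1 - z.2‖ ^ ((N : ℝ) + s₁) + |u z.1 - u z.2| ^ (p - 2) * (u z.1 - u z.2) *
        (max (u z.1 - k) 0 * ψ z.1 ^ p - max (u z.2 - k) 0 * ψ z.2 ^ p) /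
          ‖z.1 - z.2‖ ^ ((N : ℝ) + sp * p)) = 0 := by
    rw [integral_const_mul, integral_add iF1 iF2, heq, mul_zero]
  have hg₁m : Measurable (B.indicator fun x => max (u x - k) 0) :=
    Measurable.indicator (by fun_prop) hB
  have hg₁0 : ∀ x, 0 ≤ B.indicator (fun x => max (u x - k) 0) x :=
    fun x => indicator_nonneg (fun x _ => hw0 x) x
  have hg₂m : Measurable (B.indicator fun x => max (u x - k) 0 ^ p) :=
    Measurable.indicator (by fun_prop) hB
  have hg₂0 : ∀ x, 0 ≤ B.indicator (fun x => max (u x - k) 0 ^ p) x :=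
    fun x => indicator_nonneg (fun x _ => Real.rpow_nonneg (hw0 x) _) x
  have htm := measurable_tailTerm (a := sp * p) (p := p) hB hu hφm
  set R₁ : Eucl N × Eucl N → ℝ := fun z => (B.indicator (fun x => max (u x - k) 0) z.1 +
        B.indicator (fun x => max (u x - k) 0) z.2) * truncKernel s₁ 1 (p * L) z with hR₁
  set R₂ : Eucl N × Eucl N → ℝ := fun z => (B.indicator (fun x => max (u x - k) 0 ^ p) z.1 +
        B.indicator (fun x => max (u x - k) 0 ^ p) z.2) * truncKernel (sp * p) p L z with hR₂
  set R₃ : Eucl N × Eucl N → ℝ := fun z =>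
    tailTerm (sp * p) p B u (fun x => max (u x - k) 0 * ψ x ^ p) z +
      tailTerm (sp * p) p B u (fun x => max (u x - k) 0 * ψ x ^ p) z.swap with hR₃
  have hR₁m : Measurable R₁ :=
    ((hg₁m.comp measurable_fst).add (hg₁m.comp measurable_snd)).mul measurable_truncKernel
  have hR₂m : Measurable R₂ :=
    ((hg₂m.comp measurable_fst).add (hg₂m.comp measurable_snd)).mul measurable_truncKernel
  have hR₃m : Measurable R₃ := htm.add (htm.comp measurable_swap)
  have hR₁0 : ∀ z, 0 ≤ R₁ z :=
    fun z => mul_nonneg (add_nonneg (hg₁0 _) (hg₁0 _)) (truncKernel_nonneg hpL.le z)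
  have hR₂0 : ∀ z, 0 ≤ R₂ z :=
    fun z => mul_nonneg (add_nonneg (hg₂0 _) (hg₂0 _)) (truncKernel_nonneg hL.le z)
  have hR₃0 : ∀ z, 0 ≤ R₃ z :=
    fun z => add_nonneg (tailTerm_nonneg hφ0 _) (tailTerm_nonneg hφ0 _)
  have hmain := lintegral_le_of_integral_eq_zero
    (G := fun z => diffQuot s₁ 1 (fun x => max (u x - k) 0 * ψ x ^ p) z +
      diffQuot (sp * p) p (fun x => max (u x - k) 0 * ψ x) z)
    (R := fun z => (c * 2) * R₁ z + C₃ * (R₂ z + R₃ z)) i0 h0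
    (Measurable.aestronglyMeasurable (by fun_prop))
    (fun z => add_nonneg (mul_nonneg (by positivity) (hR₁0 z))
      (mul_nonneg hC₃.le (add_nonneg (hR₂0 z) (hR₃0 z))))
    (fun z => add_nonneg (diffQuot_nonneg _ _ _ z) (diffQuot_nonneg _ _ _ z))
    (hZs.mono fun z hz => by
      have h1 := diffQuot_one_le_sgn_mul (a := s₁) (k := k) hpL hΨ hz
      have h2 := hpt (u := u) hk hL hψ z
      have h3 := diffQuot_nonneg s₁ 1 (fun x => max (u x - k) 0 * ψ x ^ p) z
      have h4 := le_mul_of_one_le_left (h3.trans h1) hc1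
      have h5 := add_le_add (h1.trans h4) h2
      simp only [hR₁, hR₂, hR₃, Pi.add_apply]
      refine h5.trans (le_of_eq ?_)
      ring)
  rw [gagliardo_univ, gagliardo_univ, mul_one, ← lintegral_add_left
    (measurable_diffQuot hφm).ennreal_ofReal]
  have hLHS : ∀ z : Eucl N × Eucl N, ENNReal.ofReal (diffQuot s₁ 1
      (fun x => max (u x - k) 0 * ψ x ^ p) z) + ENNReal.ofReal (diffQuot (sp * p) p
        (fun x => max (u x - k) 0 * ψ x) z) = ENNReal.ofReal (diffQuot s₁ 1
      (fun x => max (u x - k) 0 * ψ x ^ p) z + diffQuot (sp * p) p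
        (fun x => max (u x - k) 0 * ψ x) z) := fun z =>
    (ENNReal.ofReal_add (diffQuot_nonneg _ _ _ z) (diffQuot_nonneg _ _ _ z)).symm
  simp only [hLHS]
  refine hmain.trans ?_
  have hRHS : ∀ z : Eucl N × Eucl N, ENNReal.ofReal ((c * 2) * R₁ z + C₃ * (R₂ z + R₃ z)) =
      ENNReal.ofReal (c * 2) * ENNReal.ofReal (R₁ z) + ENNReal.ofReal C₃ *
        (ENNReal.ofReal (R₂ z) + ENNReal.ofReal (R₃ z)) := fun z => by
    rw [ENNReal.ofReal_add (mul_nonneg (by positivity) (hR₁0 z))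
      (mul_nonneg hC₃.le (add_nonneg (hR₂0 z) (hR₃0 z))), ENNReal.ofReal_mul (by positivity),
      ENNReal.ofReal_mul hC₃.le, ENNReal.ofReal_add (hR₂0 z) (hR₃0 z)]
  simp only [hRHS]
  rw [lintegral_add_left (by fun_prop), lintegral_const_mul _ (by fun_prop),
    lintegral_const_mul _ (by fun_prop), lintegral_add_left (by fun_prop)]
  have k1 := hker₁ (p * L) hpL _ hg₁m hg₁0
  have k2 := hker₂ L hL _ hg₂m hg₂0
  rw [lintegral_ofReal_indicator hB] at k1 k2
  have k3 := lintegral_tailTerm_add_swap_le (a := sp * p) (p := p) hB hu hφm hφ0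
    (fun x hx => hτ x (hτ' x (right_ne_zero_of_mul hx)))
  have k4 : ∫⁻ x, ENNReal.ofReal (max (u x - k) 0 * ψ x ^ p) ≤
      ∫⁻ x in B, ENNReal.ofReal (max (u x - k) 0) := by
    rw [← lintegral_ofReal_indicator hB]
    refine lintegral_mono fun x => ENNReal.ofReal_le_ofReal ?_
    by_cases hx : x ∈ B
    · rw [indicator_of_mem hx]
      exact mul_le_of_le_one_right (hw0 x) (hΨ.mem_Icc x).2
    · simp [hx, hψ.eq_zero hx, Real.zero_rpow hp0]
  generalize (∫⁻ x in B, ENNReal.ofReal (max (u x - k) 0)) = I₁ at *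
  generalize (∫⁻ x in B, ENNReal.ofReal (max (u x - k) 0 ^ p)) = I₂ at *
  have k3' := k3.trans (mul_le_mul_right (mul_le_mul_left k4 (ENNReal.ofReal τ)) 2)
  calc _ ≤ ENNReal.ofReal (c * 2) * (ENNReal.ofReal (C₁ * (p * L) ^ s₁) * I₁) +
        ENNReal.ofReal C₃ * (ENNReal.ofReal (C₂ * L ^ (sp * p)) * I₂ +
          2 * (I₁ * ENNReal.ofReal τ)) := by gcongr
    _ = ENNReal.ofReal (c * 2 * (C₁ * (p * L) ^ s₁) + C₃ * 2 * τ) * I₁ +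
        ENNReal.ofReal (C₃ * C₂ * L ^ (sp * p)) * I₂ := by
      have e2 : (2 : ENNReal) = ENNReal.ofReal 2 := by simp
      rw [e2, mul_add, ENNReal.ofReal_add (by positivity) (by positivity),
        ENNReal.ofReal_mul (p := c * 2) (by positivity), ENNReal.ofReal_mul (p := C₃ * 2) (by positivity),
        ENNReal.ofReal_mul (p := C₃) (q := 2) (by positivity), mul_assoc C₃ C₂,
        ENNReal.ofReal_mul (p := C₃) (by positivity)]
      ring
    _ ≤ _ := by
      rw [Real.mul_rpow (by positivity) hL.le]
      have h1 : 0 ≤ L ^ s₁ := by positivity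
      have h2 : 0 ≤ L ^ (sp * p) := by positivity
      have h3 : 0 ≤ C₃ * C₂ := by positivity
      have h4 : 0 ≤ c * 2 * (C₁ * p ^ s₁) := by positivity
      gcongr
      · have a1 := mul_nonneg h3 h1
        have a2 := mul_nonneg h3 hτ0
        have a3 := mul_nonneg h4 hτ0
        have a4 := mul_nonneg hC₃.le h1
        linarith
      · linarith

end Caccioppoli

/-! ### Growth of `H_r` and `h_r` -/

section Growth

variable {p s₁ sp r : ℝ}

theorem bigH_eq_mul_smallH (hp : 1 < p) {t : ℝ} (ht : 0 ≤ t) :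
    bigH p s₁ sp r t = t * smallH p s₁ sp r t := by
  rw [bigH, smallH, ← rpow_sub_one_mul_self hp ht]
  ring

theorem bigH_nonneg (hr : 0 < r) {t : ℝ} (ht : 0 ≤ t) : 0 ≤ bigH p s₁ sp r t := by
  unfold bigH; positivity

theorem bigH_pos (hr : 0 < r) {t : ℝ} (ht : 0 < t) : 0 < bigH p s₁ sp r t := by
  unfold bigH; positivity

theorem bigH_mono (hp : 1 < p) (hr : 0 < r) {s t : ℝ} (hs : 0 ≤ s) (hst : s ≤ t) :
    bigH p s₁ sp r s ≤ bigH p s₁ sp r t := by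
  have := Real.rpow_le_rpow hs hst (by linarith : 0 ≤ p)
  unfold bigH
  gcongr

theorem smallH_mono (hp : 1 < p) (hr : 0 < r) {s t : ℝ} (hs : 0 ≤ s) (hst : s ≤ t) :
    smallH p s₁ sp r s ≤ smallH p s₁ sp r t := by
  have := Real.rpow_le_rpow hs hst (by linarith : 0 ≤ p - 1)
  unfold smallH
  gcongr

theorem smallH_nonneg (hr : 0 < r) {t : ℝ} (ht : 0 ≤ t) : 0 ≤ smallH p s₁ sp r t := by
  unfold smallH; positivity

theorem smallH_mul_le (hp : 1 < p) (hr : 0 < r) {c t : ℝ} (hc : 1 ≤ c) (ht : 0 ≤ t) :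
    smallH p s₁ sp r (c * t) ≤ c ^ (p - 1) * smallH p s₁ sp r t := by
  have h1 : 1 ≤ c ^ (p - 1) := Real.one_le_rpow hc (by linarith)
  have h2 : 0 ≤ 1 / r ^ s₁ := by positivity
  have h3 := le_mul_of_one_le_left h2 h1
  rw [smallH, smallH, Real.mul_rpow (by linarith) ht, mul_add, mul_div_assoc]
  linarith

theorem bigH_mul_le (hp : 1 < p) (hr : 0 < r) {c t : ℝ} (hc : 1 ≤ c) (ht : 0 ≤ t) :
    bigH p s₁ sp r (c * t) ≤ c ^ p * bigH p s₁ sp r t := by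
  have hc0 : 0 ≤ c := by linarith
  rw [bigH_eq_mul_smallH hp (mul_nonneg hc0 ht), bigH_eq_mul_smallH hp ht,
    ← rpow_sub_one_mul_self hp hc0]
  have := mul_le_mul_of_nonneg_left (smallH_mul_le (s₁ := s₁) (sp := sp) hp hr hc ht)
    (mul_nonneg hc0 ht)
  linarith

/-- Superlinearity, from the monotonicity of `h_r`: a constant in front of `H_r` can be moved into
its argument. -/
theorem mul_bigH_le (hp : 1 < p) (hr : 0 < r) {c t : ℝ} (hc : 1 ≤ c) (ht : 0 ≤ t) :
    c * bigH p s₁ sp r t ≤ bigH p s₁ sp r (c * t) := by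
  have hct : t ≤ c * t := le_mul_of_one_le_left ht hc
  rw [bigH_eq_mul_smallH hp (mul_nonneg (by linarith) ht), bigH_eq_mul_smallH hp ht, ← mul_assoc]
  exact mul_le_mul_of_nonneg_left (smallH_mono hp hr ht hct) (mul_nonneg (by linarith) ht)

@[fun_prop]
theorem measurable_bigH : Measurable (bigH p s₁ sp r) := by
  unfold bigH
  fun_prop

end Growth

/-! ### Radial cutoffs, off-centre tails and geometric decay -/

/-- The radial cutoff function between two concentric balls. -/
theorem exists_isCutoff_ball {N : ℕ} (x₀ : Eucl N) {ρ' ρ : ℝ} (hρ : ρ' < ρ) :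
    ∃ ψ : Eucl N → ℝ, IsCutoff (Metric.ball x₀ ρ) (2 / (ρ - ρ')) ψ ∧
      ∀ x ∈ Metric.ball x₀ ρ', ψ x = 1 := by
  set L : ℝ := 2 / (ρ - ρ') with hL
  have hd : 0 < ρ - ρ' := by linarith
  have hLpos : 0 < L := by positivity
  have hLd : L * (ρ - ρ') = 2 := by rw [hL]; field_simp
  -- With slope `L = 2 / (ρ - ρ')` the function falls from 1 to 0 over the inner half of the
  -- annulus; the outer half, of width `1 / L`, is the gap.
  refine ⟨fun x => max 0 (min 1 (1 - L * (‖x - x₀‖ - ρ'))), ⟨fun x => ?_, fun x y => ?_,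
    fun x y hx hy => ?_⟩, fun x hx => ?_⟩
  · exact ⟨le_max_left _ _, max_le zero_le_one (min_le_left _ _)⟩
  · have hI : ∀ a : ℝ, max 0 (min 1 a) ∈ Icc (0 : ℝ) 1 :=
      fun a => ⟨le_max_left _ _, max_le zero_le_one (min_le_left _ _)⟩
    refine le_min ?_ ?_
    · have h1 := hI (1 - L * (‖x - x₀‖ - ρ'))
      have h2 := hI (1 - L * (‖y - x₀‖ - ρ'))
      rw [abs_le]
      constructor <;> linarith [h1.1, h1.2, h2.1, h2.2]
    · have h1 := abs_max_sub_max_le_max 0 (min 1 (1 - L * (‖x - x₀‖ - ρ'))) 0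
        (min 1 (1 - L * (‖y - x₀‖ - ρ')))
      have h2 := abs_min_sub_min_le_max 1 (1 - L * (‖x - x₀‖ - ρ')) 1 (1 - L * (‖y - x₀‖ - ρ'))
      rw [sub_self, abs_zero, max_eq_right (abs_nonneg (min 1 (1 - L * (‖x - x₀‖ - ρ')) -
        min 1 (1 - L * (‖y - x₀‖ - ρ'))))] at h1
      rw [sub_self, abs_zero, max_eq_right (abs_nonneg (1 - L * (‖x - x₀‖ - ρ') -
        (1 - L * (‖y - x₀‖ - ρ'))))] at h2
      refine (h1.trans h2).trans ?_
      have e : 1 - L * (‖x - x₀‖ - ρ') - (1 - L * (‖y - x₀‖ - ρ')) =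
        L * (‖y - x₀‖ - ‖x - x₀‖) := by ring
      rw [e, abs_mul, abs_of_pos hLpos, abs_sub_comm]
      have := abs_norm_sub_norm_le (x - x₀) (y - x₀)
      rw [sub_sub_sub_cancel_right] at this
      gcongr
  · have h1 : 0 < 1 - L * (‖x - x₀‖ - ρ') := by
      by_contra h
      exact hx (max_eq_left ((min_le_right _ _).trans (not_lt.1 h)))
    have h2 : ρ ≤ ‖y - x₀‖ := by
      simpa [dist_eq_norm] using hy
    have h3 : ‖y - x₀‖ ≤ ‖x - y‖ + ‖x - x₀‖ := by
      have := norm_sub_le_norm_sub_add_norm_sub y x x₀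
      rwa [norm_sub_rev y x] at this
    have h4 : L * ρ ≤ L * (‖x - y‖ + ‖x - x₀‖) := by gcongr; linarith
    linarith
  · have h1 : ‖x - x₀‖ < ρ' := by simpa [dist_eq_norm] using hx
    have h2 : 0 ≤ L * (ρ' - ‖x - x₀‖) := mul_nonneg hLpos.le (by linarith)
    have h3 : 1 ≤ 1 - L * (‖x - x₀‖ - ρ') := by linarith
    simp [min_eq_left h3]

/-- Comparison of the tail seen from the support of a cutoff function with the tail seen from the
centre of the ball. -/
theorem lintegral_compl_ball_le {N : ℕ} {a p : ℝ} (ha : 0 < a) {x₀ : Eucl N} {ρ r L : ℝ}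
    {u ψ : Eucl N → ℝ} (hr : 0 < r) (hL : 0 < L) (hρ : r / 2 ≤ ρ) (hρr : ρ ≤ r)
    (hψ : IsCutoff (Metric.ball x₀ ρ) L ψ) {T : ℝ}
    (hT : ∫⁻ y in (Metric.ball x₀ (r / 2))ᶜ,
      ENNReal.ofReal (|u y| ^ (p - 1) / ‖y - x₀‖ ^ ((N : ℝ) + a)) ≤ ENNReal.ofReal T)
    {x : Eucl N} (hx : ψ x ≠ 0) :
    ∫⁻ y in (Metric.ball x₀ ρ)ᶜ, ENNReal.ofReal (|u y| ^ (p - 1) / ‖x - y‖ ^ ((N : ℝ) + a)) ≤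
      ENNReal.ofReal ((1 + r * L) ^ ((N : ℝ) + a) * T) := by
  have hc : 0 ≤ (1 + r * L) ^ ((N : ℝ) + a) := by positivity
  calc _ ≤ ∫⁻ y in (Metric.ball x₀ ρ)ᶜ, ENNReal.ofReal ((1 + r * L) ^ ((N : ℝ) + a)) *
        ENNReal.ofReal (|u y| ^ (p - 1) / ‖y - x₀‖ ^ ((N : ℝ) + a)) := by
        refine setLIntegral_mono' Metric.isOpen_ball.measurableSet.compl fun y hy => ?_
        rw [← ENNReal.ofReal_mul hc]
        refine ENNReal.ofReal_le_ofReal ?_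
        have hxB : x ∈ Metric.ball x₀ ρ := by
          by_contra h
          exact hx (hψ.eq_zero h)
        have h1 : ‖x - x₀‖ ≤ r := by
          have : ‖x - x₀‖ < ρ := by simpa [dist_eq_norm] using hxB
          linarith
        have h2 : ρ ≤ ‖y - x₀‖ := by simpa [dist_eq_norm] using hy
        have h3 := hψ.gap x y hx hy
        have h4 : 0 < ‖x - y‖ := by
          by_contra h
          have h0 : ‖x - y‖ = 0 := le_antisymm (not_lt.1 h) (norm_nonneg _)
          rw [h0] at h3; linarith
        have h5 : 0 < ‖y - x₀‖ := by linarith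
        -- Triangle inequality through `x`, with `‖x - x₀‖ ≤ r ≤ r * L * ‖x - y‖` by the gap
        -- condition.
        have h6 : ‖y - x₀‖ ≤ (1 + r * L) * ‖x - y‖ := by
          have := norm_sub_le_norm_sub_add_norm_sub y x x₀
          rw [norm_sub_rev y x] at this
          have := mul_le_mul_of_nonneg_left h3 hr.le
          linarith
        have h7 := Real.rpow_le_rpow h5.le h6 (by positivity : 0 ≤ (N : ℝ) + a)
        rw [Real.mul_rpow (by positivity) h4.le] at h7
        rw [← mul_div_assoc, div_le_div_iff₀ (by positivity) (by positivity)]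
        have := mul_le_mul_of_nonneg_left h7 (by positivity : 0 ≤ |u y| ^ (p - 1))
        linarith
    _ = ENNReal.ofReal ((1 + r * L) ^ ((N : ℝ) + a)) * ∫⁻ y in (Metric.ball x₀ ρ)ᶜ,
        ENNReal.ofReal (|u y| ^ (p - 1) / ‖y - x₀‖ ^ ((N : ℝ) + a)) :=
        lintegral_const_mul' _ _ ENNReal.ofReal_ne_top
    _ ≤ ENNReal.ofReal ((1 + r * L) ^ ((N : ℝ) + a)) * ENNReal.ofReal T := by
        gcongr
        refine le_trans ?_ hT
        exact lintegral_mono_set (compl_subset_compl.2 (Metric.ball_subset_ball hρ))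
    _ = _ := (ENNReal.ofReal_mul hc).symm

/-- Fast geometric convergence. -/
theorem exists_tendsto_zero_of_le_mul_rpow {A b ε : ℝ} (hA : 0 < A) (hb : 1 < b) (hε : 0 < ε) :
    ∃ ν : ℝ, 0 < ν ∧ ∀ Y : ℕ → ℝ, (∀ j, 0 ≤ Y j) → (∀ j, Y (j + 1) ≤ A * b ^ j * Y j ^ ε * Y j) →
      Y 0 ≤ ν → Filter.Tendsto Y Filter.atTop (nhds 0) := by
  have hb0 : 0 < b := by linarith
  -- The rate satisfies `σ ^ ε = b⁻¹`, so under the bound `Y j ≤ Y 0 * σ ^ j` the factor `Y j ^ ε`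
  -- cancels `b ^ j`. The threshold is then the value `ν` with `A * ν ^ ε = σ`.
  set σ : ℝ := b ^ (-(1 / ε)) with hσ
  have hσ0 : 0 < σ := Real.rpow_pos_of_pos hb0 _
  have hσ1 : σ < 1 := Real.rpow_lt_one_of_one_lt_of_neg hb (by simpa using hε)
  have hσε : σ ^ ε = b⁻¹ := by
    rw [hσ, ← Real.rpow_mul hb0.le, neg_mul, one_div_mul_cancel hε.ne', Real.rpow_neg_one]
  refine ⟨(σ / A) ^ (1 / ε), by positivity, fun Y hY0 hY h0 => ?_⟩
  have hν : A * Y 0 ^ ε ≤ σ := by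
    have h1 := Real.rpow_le_rpow (hY0 0) h0 hε.le
    rw [← Real.rpow_mul (by positivity), one_div_mul_cancel hε.ne', Real.rpow_one,
      le_div_iff₀ hA] at h1
    linarith
  have hbound : ∀ j, Y j ≤ Y 0 * σ ^ j := by
    intro j
    induction j with
    | zero => simp
    | succ j ih =>
      have h1 : Y j ^ ε ≤ (Y 0 * σ ^ j) ^ ε := Real.rpow_le_rpow (hY0 j) ih hε.le
      have h2 : (Y 0 * σ ^ j) ^ ε = Y 0 ^ ε * (b⁻¹) ^ j := by
        rw [Real.mul_rpow (hY0 0) (by positivity), ← Real.rpow_natCast, ← Real.rpow_mul hσ0.le,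
          mul_comm (j : ℝ), Real.rpow_mul hσ0.le, hσε, Real.rpow_natCast]
      have h4 : 0 ≤ Y 0 := hY0 0
      have h5 : 0 ≤ Y j := hY0 j
      calc Y (j + 1) ≤ A * b ^ j * Y j ^ ε * Y j := hY j
        _ ≤ A * b ^ j * (Y 0 ^ ε * (b⁻¹) ^ j) * (Y 0 * σ ^ j) := by
          rw [← h2]; gcongr
        _ = A * Y 0 ^ ε * (Y 0 * σ ^ j) := by
          rw [inv_pow]; field_simp
        _ ≤ σ * (Y 0 * σ ^ j) := by gcongr
        _ = Y 0 * σ ^ (j + 1) := by ring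
  refine squeeze_zero hY0 hbound ?_
  have := (tendsto_pow_atTop_nhds_zero_of_lt_one hσ0.le hσ1).const_mul (Y 0)
  simpa using this

/-- The Faber–Krahn factor is scale invariant: its power of `r` cancels. Since `θ ≤ 1`, the exponent
can be lowered to one common to both energies. -/
theorem rpow_div_le_of_mul_rpow {N : ℕ} (hN : 0 < N) {a ε ω r θ : ℝ} (hr : 0 < r)
    (hω : 0 < ω) (hθ : 0 < θ) (hθ1 : θ ≤ 1) (hε : ε ≤ a / N) :
    1 / r ^ a * (θ * (ω * r ^ N)) ^ (a / N) ≤ ω ^ (a / N) * θ ^ ε := by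
  have hNr : (N : ℝ) ≠ 0 := by exact_mod_cast hN.ne'
  have h1 : (r ^ N) ^ (a / N) = r ^ a := by
    rw [← Real.rpow_natCast, ← Real.rpow_mul hr.le]; congr 1; field_simp
  rw [Real.mul_rpow hθ.le (by positivity), Real.mul_rpow hω.le (by positivity), h1]
  have h2 : θ ^ (a / N) ≤ θ ^ ε := Real.rpow_le_rpow_of_exponent_ge hθ hθ1 hε
  have h3 : 0 < r ^ a := by positivity
  calc 1 / r ^ a * (θ ^ (a / N) * (ω ^ (a / N) * r ^ a)) = ω ^ (a / N) * θ ^ (a / N) := by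
        field_simp
    _ ≤ _ := by gcongr

/-! ### One step between two levels -/

section Step

variable {N : ℕ} {p s₁ sp : ℝ}

/-- Powers of `L` become powers of `1 / r` through `(r * L) ^ b`. For the tail, where the upper
truncation is positive the lower one `w` is at least `h`; hence `T ≤ M * lam ^ p * h_r(w)`, and
multiplying by `w` gives `H_r(w)`. -/
theorem level_pointwise (hp : 1 < p) (hs₁ : s₁ ∈ Ioo (0 : ℝ) 1)
    (hsp : sp ∈ Ioo (0 : ℝ) 1) {r L k h lam M T a : ℝ} (hr : 0 < r) (hL : 0 < L) (hh : 0 < h)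
    (hlam : 1 ≤ lam) (hM : 0 ≤ M) (hT : T ≤ M * smallH p s₁ sp r (lam * h)) :
    (L ^ s₁ + (1 + r * L) ^ ((N : ℝ) + sp * p) * T) * max (a - (k + h)) 0 +
      L ^ (sp * p) * max (a - (k + h)) 0 ^ p ≤
    (1 + M) * (1 + r * L) ^ ((N : ℝ) + p) * lam ^ p * bigH p s₁ sp r (max (a - k) 0) := by
  have hb : 1 ≤ 1 + r * L := by have := mul_pos hr hL; linarith
  set Q : ℝ := (1 + r * L) ^ ((N : ℝ) + p) with hQ
  have hQ0 : 0 < Q := by positivity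
  have hNr : (0 : ℝ) ≤ N := Nat.cast_nonneg N
  have hspp : sp * p ≤ p := by nlinarith [hsp.2]
  have hLs : ∀ b : ℝ, 0 ≤ b → b ≤ p → L ^ b ≤ Q * (1 / r ^ b) := by
    intro b hb0 hbp
    have h1 : (r * L) ^ b ≤ Q :=
      (Real.rpow_le_rpow (by positivity) (by linarith) hb0).trans
        (Real.rpow_le_rpow_of_exponent_le hb (by linarith))
    rw [Real.mul_rpow hr.le hL.le] at h1
    rw [mul_one_div, le_div_iff₀ (by positivity)]
    linarith
  have hQ' : (1 + r * L) ^ ((N : ℝ) + sp * p) ≤ Q :=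
    Real.rpow_le_rpow_of_exponent_le hb (by linarith)
  set w' : ℝ := max (a - (k + h)) 0 with hw'
  set w : ℝ := max (a - k) 0 with hw
  have hw'0 : 0 ≤ w' := le_max_right _ _
  have hw0 : 0 ≤ w := le_max_right _ _
  have hww : w' ≤ w := max_le_max (by linarith) le_rfl
  have hlam1 : 1 ≤ lam ^ p := Real.one_le_rpow hlam (by linarith)
  have hH0 := bigH_nonneg (p := p) (s₁ := s₁) (sp := sp) hr hw0
  have h1 : (L ^ s₁) * w' + L ^ (sp * p) * w' ^ p ≤ Q * bigH p s₁ sp r w := by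
    have e1 := mul_le_mul_of_nonneg_right (hLs s₁ hs₁.1.le (by linarith [hs₁.2])) hw'0
    have e2 := mul_le_mul_of_nonneg_right (hLs (sp * p) (by have := hsp.1; positivity) hspp)
      (Real.rpow_nonneg hw'0 p)
    have e3 := mul_le_mul_of_nonneg_left (bigH_mono (s₁ := s₁) (sp := sp) hp hr hw'0 hww) hQ0.le
    have e4 : Q * bigH p s₁ sp r w' = Q * (1 / r ^ s₁) * w' + Q * (1 / r ^ (sp * p)) * w' ^ p := by
      rw [bigH]; ring
    linarith
  have h2 : T * w' ≤ M * lam ^ p * bigH p s₁ sp r w := by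
    rcases hw'0.eq_or_lt with h0 | h0
    · rw [← h0, mul_zero]; positivity
    · have ha : h ≤ w := by
        have : 0 < a - (k + h) := by
          by_contra hc
          rw [hw', max_eq_right (not_lt.1 hc)] at h0
          exact lt_irrefl _ h0
        exact le_max_of_le_left (by linarith)
      have hsm := smallH_nonneg (p := p) (s₁ := s₁) (sp := sp) hr hw0
      have h3 : smallH p s₁ sp r (lam * h) ≤ lam ^ p * smallH p s₁ sp r w := by
        refine (smallH_mul_le hp hr hlam hh.le).trans ?_
        refine mul_le_mul (Real.rpow_le_rpow_of_exponent_le hlam (by linarith))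
          (smallH_mono hp hr hh.le ha) (smallH_nonneg hr hh.le) (by positivity)
      have h4 : T ≤ M * (lam ^ p * smallH p s₁ sp r w) := hT.trans (by gcongr)
      have h5 : T * w' ≤ M * (lam ^ p * smallH p s₁ sp r w) * w :=
        mul_le_mul h4 hww hw'0 (by positivity)
      rw [bigH_eq_mul_smallH hp hw0]
      linarith
  have h3 : (1 + r * L) ^ ((N : ℝ) + sp * p) * (T * w') ≤ Q * (M * lam ^ p * bigH p s₁ sp r w) := by
    refine (mul_le_mul_of_nonneg_left h2 (by positivity)).trans ?_
    gcongr
  have h4 := le_mul_of_one_le_left (mul_nonneg hQ0.le hH0) hlam1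
  linarith

/-- One step of the De Giorgi iteration. -/
theorem exists_level_step (hN : 0 < N) (hp : 1 < p) (hs₁ : s₁ ∈ Ioo (0 : ℝ) 1)
    (hsp : sp ∈ Ioo (0 : ℝ) 1) : ∃ C : ℝ, 0 < C ∧ ∀ (Ω : Set (Eucl N)) (u : Eucl N → ℝ),
    Measurable u → IsWeakSolution p s₁ sp Ω u → ∀ (x₀ : Eucl N) (r T M : ℝ), 0 < r → 0 ≤ T →
    0 ≤ M → closure (Metric.ball x₀ r) ⊆ Ω →
    ∫⁻ y in (Metric.ball x₀ (r / 2))ᶜ,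
      ENNReal.ofReal (|u y| ^ (p - 1) / ‖y - x₀‖ ^ ((N : ℝ) + sp * p)) ≤ ENNReal.ofReal T →
    ∀ k h lam ρ' ρ θ : ℝ, 0 ≤ k → 0 < h → 1 ≤ lam → T ≤ M * smallH p s₁ sp r (lam * h) →
    r / 2 ≤ ρ' → ρ' < ρ → ρ ≤ r → 0 < θ → θ ≤ 1 →
    volume {x | x ∈ Metric.ball x₀ ρ ∧ k + h < u x} ≤
      ENNReal.ofReal (θ * ((volume (Metric.ball (0 : Eucl N) 1)).toReal * r ^ N)) →
    ∫⁻ x in Metric.ball x₀ ρ', ENNReal.ofReal (bigH p s₁ sp r (max (u x - (k + h)) 0)) ≤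
      ENNReal.ofReal (C * (1 + M) * (1 + r * (2 / (ρ - ρ'))) ^ ((N : ℝ) + p) * lam ^ p *
        θ ^ (min s₁ (sp * p) / N)) *
      ∫⁻ x in Metric.ball x₀ ρ, ENNReal.ofReal (bigH p s₁ sp r (max (u x - k) 0)) := by
  obtain ⟨C₁, hC₁, hfk₁⟩ := exists_lintegral_rpow_le_gagliardo hN hs₁.1 one_pos
  obtain ⟨C₂, hC₂, hfk₂⟩ := exists_lintegral_rpow_le_gagliardo hN hsp.1 (q := p) (by linarith)
  obtain ⟨C₃, hC₃, hcac⟩ := exists_caccioppoli hN hp hs₁ hsp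
  set ω : ℝ := (volume (Metric.ball (0 : Eucl N) 1)).toReal with hω
  have hωpos : 0 < ω := ENNReal.toReal_pos (Metric.measure_ball_pos _ _ one_pos).ne'
    measure_ball_lt_top.ne
  have hNr : (0 : ℝ) < N := by exact_mod_cast hN
  set D : ℝ := C₁ * ω ^ (s₁ / N) + C₂ * ω ^ (sp * p / N) with hD
  refine ⟨D * C₃, by positivity, ?_⟩
  intro Ω u hu hsol x₀ r T M hr hT0 hM hBΩ hT k h lam ρ' ρ θ hk hh hlam hTK hρ' hρρ' hρ hθ hθ1 hvol
  obtain ⟨ψ, hψ, hψ1⟩ := exists_isCutoff_ball x₀ hρρ'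
  set L : ℝ := 2 / (ρ - ρ') with hLdef
  have hL : 0 < L := div_pos two_pos (by linarith)
  set B := Metric.ball x₀ ρ with hBdef
  have hBB : closure B ⊆ closure (Metric.ball x₀ r) := closure_mono (Metric.ball_subset_ball hρ)
  have hp0 : p ≠ 0 := by linarith
  have hψm : Measurable ψ := (hψ.continuous hL.le).measurable
  have hcac := hcac Ω u hu hsol B L ψ (k + h) ((1 + r * L) ^ ((N : ℝ) + sp * p) * T)
    Metric.isOpen_ball (Metric.isBounded_ball.isCompact_closure) (hBB.trans hBΩ) hL hψ
    (by linarith) (by positivity) (fun x hx => lintegral_compl_ball_le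
      (by have := hsp.1; positivity) hr hL (by linarith) hρ hψ hT hx)
  set w : Eucl N → ℝ := fun x => max (u x - (k + h)) 0 with hw
  have hwm : Measurable w := by fun_prop
  have hw0 : ∀ x, 0 ≤ w x := fun x => le_max_right _ _
  set e : ℝ := θ * (ω * r ^ N) with he
  have he0 : 0 < e := by positivity
  have hsupp : ∀ s : Eucl N → ℝ, (∀ x, ψ x = 0 → s x = 0) →
      volume {x | w x * s x ≠ 0} ≤ ENNReal.ofReal e := by
    intro s hs
    refine (measure_mono fun x hx => ?_).trans hvol
    refine ⟨?_, ?_⟩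
    · by_contra hxB
      exact hx (by rw [hs x (hψ.eq_zero hxB), mul_zero])
    · by_contra hxk
      have : w x = 0 := max_eq_right (by linarith [not_lt.1 hxk])
      exact hx (by rw [this, zero_mul])
  have k1 := hfk₁ (fun x => w x * ψ x ^ p) (by fun_prop) e he0
    (hsupp _ fun x hx => by rw [hx, Real.zero_rpow hp0])
  have k2 := hfk₂ (fun x => w x * ψ x) (by fun_prop) e he0 (hsupp _ fun x hx => hx)
  rw [mul_one] at k1
  set G₁ := gagliardo s₁ 1 univ fun x => w x * ψ x ^ p
  set G₂ := gagliardo sp p univ fun x => w x * ψ x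
  have hB'm : MeasurableSet (Metric.ball x₀ ρ') := Metric.isOpen_ball.measurableSet
  have hr1 : 0 ≤ 1 / r ^ s₁ := by positivity
  have hr2 : 0 ≤ 1 / r ^ (sp * p) := by positivity
  -- On the smaller ball `ψ = 1`, so the two summands of `H_r` are integrals of the functions whose
  -- energies the Caccioppoli inequality bounds.
  have step1 : ∫⁻ x in Metric.ball x₀ ρ', ENNReal.ofReal (bigH p s₁ sp r (w x)) ≤
      ENNReal.ofReal (1 / r ^ s₁) * (∫⁻ x, ENNReal.ofReal (|w x * ψ x ^ p| ^ (1 : ℝ))) +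
      ENNReal.ofReal (1 / r ^ (sp * p)) * ∫⁻ x, ENNReal.ofReal (|w x * ψ x| ^ p) := by
    rw [← lintegral_const_mul _ (by fun_prop), ← lintegral_const_mul _ (by fun_prop),
      ← lintegral_add_left (by fun_prop)]
    refine le_trans ?_ (setLIntegral_le_lintegral (Metric.ball x₀ ρ') _)
    refine setLIntegral_mono' hB'm fun x hx => ?_
    rw [hψ1 x hx, Real.one_rpow, mul_one, abs_of_nonneg (hw0 x), Real.rpow_one,
      ← ENNReal.ofReal_mul hr1, ← ENNReal.ofReal_mul hr2,
      ← ENNReal.ofReal_add (mul_nonneg hr1 (hw0 x)) (mul_nonneg hr2 (Real.rpow_nonneg (hw0 x) p))]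
    refine ENNReal.ofReal_le_ofReal (le_of_eq ?_)
    rw [bigH]; ring
  set ε : ℝ := min s₁ (sp * p) / N with hε
  have hε1 : ε ≤ s₁ / N := div_le_div_of_nonneg_right (min_le_left _ _) hNr.le
  have hε2 : ε ≤ sp * p / N := div_le_div_of_nonneg_right (min_le_right _ _) hNr.le
  have c1 : ENNReal.ofReal (1 / r ^ s₁) * ENNReal.ofReal (C₁ * e ^ (s₁ / N)) ≤
      ENNReal.ofReal (D * θ ^ ε) := by
    rw [← ENNReal.ofReal_mul hr1]
    refine ENNReal.ofReal_le_ofReal ?_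
    have h1 := rpow_div_le_of_mul_rpow hN hr hωpos hθ hθ1 hε1
    have h2 := mul_le_mul_of_nonneg_left h1 hC₁.le
    have h3 : 0 ≤ C₂ * ω ^ (sp * p / N) * θ ^ ε := by positivity
    rw [hD]
    linarith
  have c2 : ENNReal.ofReal (1 / r ^ (sp * p)) * ENNReal.ofReal (C₂ * e ^ (sp * p / N)) ≤
      ENNReal.ofReal (D * θ ^ ε) := by
    rw [← ENNReal.ofReal_mul hr2]
    refine ENNReal.ofReal_le_ofReal ?_
    have h1 := rpow_div_le_of_mul_rpow hN hr hωpos hθ hθ1 hε2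
    have h2 := mul_le_mul_of_nonneg_left h1 hC₂.le
    have h3 : 0 ≤ C₁ * ω ^ (s₁ / N) * θ ^ ε := by positivity
    rw [hD]
    linarith
  have hBm : MeasurableSet B := Metric.isOpen_ball.measurableSet
  have hcL : 0 ≤ C₃ * (L ^ s₁ + (1 + r * L) ^ ((N : ℝ) + sp * p) * T) := by positivity
  have hcL' : 0 ≤ C₃ * L ^ (sp * p) := by positivity
  have step3 : G₁ + G₂ ≤ ENNReal.ofReal (C₃ * ((1 + M) * (1 + r * L) ^ ((N : ℝ) + p) * lam ^ p)) *
      ∫⁻ x in B, ENNReal.ofReal (bigH p s₁ sp r (max (u x - k) 0)) := by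
    refine hcac.trans ?_
    rw [← lintegral_const_mul _ (by fun_prop), ← lintegral_const_mul _ (by fun_prop),
      ← lintegral_const_mul _ (by fun_prop), ← lintegral_add_left (by fun_prop)]
    refine lintegral_mono fun x => ?_
    simp only
    rw [← ENNReal.ofReal_mul hcL, ← ENNReal.ofReal_mul hcL', ← ENNReal.ofReal_mul (by positivity),
      ← ENNReal.ofReal_add (mul_nonneg hcL (hw0 x)) (mul_nonneg hcL' (Real.rpow_nonneg (hw0 x) p))]
    refine ENNReal.ofReal_le_ofReal ?_
    have := mul_le_mul_of_nonneg_left (level_pointwise (N := N) (k := k) (a := u x) hp hs₁ hsp hr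
      hL hh hlam hM hTK) hC₃.le
    simp only [hw]
    linarith
  calc _ ≤ ENNReal.ofReal (1 / r ^ s₁) * (ENNReal.ofReal (C₁ * e ^ (s₁ / N)) * G₁) +
        ENNReal.ofReal (1 / r ^ (sp * p)) * (ENNReal.ofReal (C₂ * e ^ (sp * p / N)) * G₂) :=
        step1.trans (by gcongr)
    _ ≤ ENNReal.ofReal (D * θ ^ ε) * G₁ + ENNReal.ofReal (D * θ ^ ε) * G₂ := by
        rw [← mul_assoc, ← mul_assoc]
        gcongr
    _ = ENNReal.ofReal (D * θ ^ ε) * (G₁ + G₂) := by rw [mul_add]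
    _ ≤ ENNReal.ofReal (D * θ ^ ε) * (ENNReal.ofReal (C₃ * ((1 + M) *
        (1 + r * L) ^ ((N : ℝ) + p) * lam ^ p)) *
          ∫⁻ x in B, ENNReal.ofReal (bigH p s₁ sp r (max (u x - k) 0))) := by gcongr
    _ = _ := by
        rw [← mul_assoc, ← ENNReal.ofReal_mul (by positivity)]
        congr 2
        ring

end Step

/-! ### The De Giorgi iteration -/

section Iteration

variable {N : ℕ} {p s₁ sp : ℝ}

/-- Chebyshev at height `h`. Trading `H_r(h)` for `H_r(lam * h)` costs `lam ^ p` and lets every step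
be normalised by the same `H_r(K)`. -/
theorem measure_superlevel_le (hp : 1 < p) {r h k lam V : ℝ} (hr : 0 < r) (hh : 0 < h)
    (hlam : 1 ≤ lam) (hV : 0 < V) {u : Eucl N → ℝ} (hu : Measurable u) {B : Set (Eucl N)}
    (hB : MeasurableSet B)
    (hfin : ∫⁻ x in B, ENNReal.ofReal (bigH p s₁ sp r (max (u x - k) 0)) ≠ ⊤) :
    volume {x | x ∈ B ∧ k + h < u x} ≤ ENNReal.ofReal (lam ^ p *
      ((∫⁻ x in B, ENNReal.ofReal (bigH p s₁ sp r (max (u x - k) 0))).toReal /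
        (V * bigH p s₁ sp r (lam * h))) * V) := by
  set y := ∫⁻ x in B, ENNReal.ofReal (bigH p s₁ sp r (max (u x - k) 0)) with hy
  have hHh := bigH_pos (p := p) (s₁ := s₁) (sp := sp) hr hh
  have hHl := bigH_pos (p := p) (s₁ := s₁) (sp := sp) hr (mul_pos (by linarith : 0 < lam) hh)
  have hset : MeasurableSet {x | k + h < u x} := measurableSet_lt measurable_const hu
  have h1 : ENNReal.ofReal (bigH p s₁ sp r h) * volume {x | x ∈ B ∧ k + h < u x} ≤ y := by
    have e : {x | x ∈ B ∧ k + h < u x} = B ∩ {x | k + h < u x} := rfl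
    rw [e, ← setLIntegral_const]
    refine le_trans ?_ (lintegral_mono_set (inter_subset_left (t := {x | k + h < u x})))
    refine setLIntegral_mono' (hB.inter hset) fun x hx => ENNReal.ofReal_le_ofReal ?_
    have : k + h < u x := hx.2
    exact bigH_mono hp hr hh.le (le_max_of_le_left (by linarith))
  have h2 : volume {x | x ∈ B ∧ k + h < u x} ≤ ENNReal.ofReal (y.toReal / bigH p s₁ sp r h) := by
    rw [ENNReal.ofReal_div_of_pos hHh, ENNReal.ofReal_toReal hfin]
    rw [ENNReal.le_div_iff_mul_le (Or.inl (by simpa using hHh)) (Or.inl ENNReal.ofReal_ne_top),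
      mul_comm]
    exact h1
  refine h2.trans (ENNReal.ofReal_le_ofReal ?_)
  have h3 := bigH_mul_le (s₁ := s₁) (sp := sp) hp hr hlam hh.le
  have e : lam ^ p * (y.toReal / (V * bigH p s₁ sp r (lam * h))) * V =
      (y.toReal * lam ^ p) / bigH p s₁ sp r (lam * h) := by field_simp
  rw [e, div_le_div_iff₀ hHh hHl]
  have := mul_le_mul_of_nonneg_left h3 (ENNReal.toReal_nonneg (a := y))
  linarith

/-- The De Giorgi iteration: smallness of the average of `H_r(u_+)` relative to `H_r(K)` gives the
upper bound `K`. -/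
theorem exists_ae_le_of_lintegral_bigH_le (hN : 0 < N) (hp : 1 < p) (hs₁ : s₁ ∈ Ioo (0 : ℝ) 1)
    (hsp : sp ∈ Ioo (0 : ℝ) 1) {M : ℝ} (hM : 0 ≤ M) : ∃ ν : ℝ, 0 < ν ∧
    ∀ (Ω : Set (Eucl N)) (u : Eucl N → ℝ),
    Measurable u → IsWeakSolution p s₁ sp Ω u → ∀ (x₀ : Eucl N) (r T K : ℝ), 0 < r → 0 ≤ T →
    0 < K → closure (Metric.ball x₀ r) ⊆ Ω →
    ∫⁻ y in (Metric.ball x₀ (r / 2))ᶜ,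
      ENNReal.ofReal (|u y| ^ (p - 1) / ‖y - x₀‖ ^ ((N : ℝ) + sp * p)) ≤ ENNReal.ofReal T →
    T ≤ M * smallH p s₁ sp r K →
    ∫⁻ x in Metric.ball x₀ r, ENNReal.ofReal (bigH p s₁ sp r (max (u x) 0)) ≤
      ENNReal.ofReal (ν * bigH p s₁ sp r K *
        ((volume (Metric.ball (0 : Eucl N) 1)).toReal * r ^ N)) →
    ∀ᵐ x ∂(volume.restrict (Metric.ball x₀ (r / 2))), u x ≤ K := by
  obtain ⟨C, hC, hstep⟩ := exists_level_step hN hp hs₁ hsp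
  set ω : ℝ := (volume (Metric.ball (0 : Eucl N) 1)).toReal with hω
  have hωpos : 0 < ω := ENNReal.toReal_pos (Metric.measure_ball_pos _ _ one_pos).ne'
    measure_ball_lt_top.ne
  have hNr : (0 : ℝ) < N := by exact_mod_cast hN
  set ε : ℝ := min s₁ (sp * p) / N with hε
  have hε0 : 0 < ε := div_pos (lt_min hs₁.1 (by have := hsp.1; positivity)) hNr
  -- At step `j`, the cutoff factor is at most `9 * 2 ^ j`, which is raised to `N + p`; `lam ^ p`
  -- contributes `2 ^ p * (2 ^ p) ^ j`, and it occurs once more inside `θ ^ ε`.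
  set A : ℝ := C * (1 + M) * 9 ^ ((N : ℝ) + p) * 2 ^ p * (2 ^ p) ^ ε with hA
  set b : ℝ := 2 ^ ((N : ℝ) + p) * 2 ^ p * (2 ^ p) ^ ε with hb
  have hb1 : 1 < b := by
    have h1 : (1 : ℝ) < 2 ^ ((N : ℝ) + p) := Real.one_lt_rpow (by norm_num) (by positivity)
    have h2 : (1 : ℝ) < 2 ^ p := Real.one_lt_rpow (by norm_num) (by positivity)
    have h3 : (1 : ℝ) < (2 ^ p) ^ ε := Real.one_lt_rpow h2 hε0
    exact one_lt_mul_of_lt_of_le (one_lt_mul_of_lt_of_le h1 h2.le) h3.le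
  obtain ⟨ν, hν, hfast⟩ := exists_tendsto_zero_of_le_mul_rpow (A := A) (by positivity) hb1 hε0
  refine ⟨ν, hν, ?_⟩
  intro Ω u hu hsol x₀ r T K hr hT0 hK hBΩ hT hTK hsmall
  set V : ℝ := ω * r ^ N with hV
  have hV0 : 0 < V := by positivity
  have hHK := bigH_pos (p := p) (s₁ := s₁) (sp := sp) hr hK
  set k : ℕ → ℝ := fun j => K * (1 - (1 / 2) ^ j) with hk
  set ρ : ℕ → ℝ := fun j => r / 2 * (1 + (1 / 2) ^ j) with hρ
  set y : ℕ → ENNReal := fun j =>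
    ∫⁻ x in Metric.ball x₀ (ρ j), ENNReal.ofReal (bigH p s₁ sp r (max (u x - k j) 0)) with hy
  have hhalf0 : ∀ j : ℕ, (0 : ℝ) < (1 / 2) ^ j := fun j => by positivity
  have hhalf1 : ∀ j : ℕ, ((1 : ℝ) / 2) ^ j ≤ 1 := fun j => pow_le_one₀ (by norm_num) (by norm_num)
  have hk0 : ∀ j, 0 ≤ k j := fun j => mul_nonneg hK.le (by linarith [hhalf1 j])
  have hkK : ∀ j, k j ≤ K := fun j => mul_le_of_le_one_right hK.le (by linarith [hhalf0 j])
  have hkj : ∀ j, k (j + 1) = k j + K * (1 / 2) ^ (j + 1) := fun j => by simp only [hk]; ring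
  have hρj : ∀ j, ρ j - ρ (j + 1) = r / 2 * (1 / 2) ^ (j + 1) := fun j => by simp only [hρ]; ring
  have hρlt : ∀ j, ρ (j + 1) < ρ j := fun j => by
    have : 0 < r / 2 * (1 / 2) ^ (j + 1) := by positivity
    linarith [hρj j]
  have hρlow : ∀ j, r / 2 ≤ ρ j := fun j =>
    le_mul_of_one_le_right (by positivity) (by linarith [hhalf0 j])
  have hρup : ∀ j, ρ j ≤ r := fun j => by
    have : r / 2 * (1 + (1 / 2) ^ j) ≤ r / 2 * (1 + 1) := by gcongr; exact hhalf1 j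
    simp only [hρ]; linarith
  have hy0 : y 0 ≤ ENNReal.ofReal (ν * bigH p s₁ sp r K * V) := by
    have e1 : ρ 0 = r := by simp only [hρ]; ring
    have e2 : k 0 = 0 := by simp only [hk]; ring
    simpa only [hy, e1, e2, sub_zero] using hsmall
  have hyanti : ∀ j, y (j + 1) ≤ y j := fun j => by
    refine (lintegral_mono_set (Metric.ball_subset_ball (hρlt j).le)).trans ?_
    refine lintegral_mono fun x => ENNReal.ofReal_le_ofReal ?_
    refine bigH_mono hp hr (le_max_right _ _) (max_le_max ?_ le_rfl)
    have : 0 < K * (1 / 2) ^ (j + 1) := by positivity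
    linarith [hkj j]
  have hyfin : ∀ j, y j ≠ ⊤ := fun j => by
    refine ne_top_of_le_ne_top ENNReal.ofReal_ne_top (le_trans ?_ hy0)
    exact antitone_nat_of_succ_le hyanti (Nat.zero_le j)
  set Y : ℕ → ℝ := fun j => (y j).toReal / (V * bigH p s₁ sp r K) with hY
  have hVH : 0 < V * bigH p s₁ sp r K := by positivity
  have hY0 : ∀ j, 0 ≤ Y j := fun j => by simp only [hY]; positivity
  have hrec : ∀ j, Y (j + 1) ≤ A * b ^ j * Y j ^ ε * Y j := by
    intro j
    have hyr : (y (j + 1)).toReal ≤ (y j).toReal := ENNReal.toReal_mono (hyfin j) (hyanti j)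
    -- The level step needs `θ > 0`; once `Y j` vanishes, monotonicity of `y` makes the next term
    -- vanish too.
    rcases (hY0 j).eq_or_lt with h0 | h0
    · have : (y j).toReal = 0 := by
        have h1 : (y j).toReal / (V * bigH p s₁ sp r K) = 0 := h0.symm
        rcases div_eq_zero_iff.1 h1 with h2 | h2
        · exact h2
        · exact absurd h2 hVH.ne'
      have h2 : (y (j + 1)).toReal = 0 := le_antisymm (hyr.trans this.le) ENNReal.toReal_nonneg
      rw [← h0, mul_zero]
      simp [hY, h2]
    -- This multiplier takes the level gap `K * (1 / 2) ^ (j + 1)` back to `K`, so the tail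
    -- hypothesis at `K` serves at every step.
    · set lam : ℝ := 2 ^ (j + 1) with hlam
      have hlam1 : 1 ≤ lam := one_le_pow₀ (by norm_num)
      have hlamK : lam * (K * (1 / 2) ^ (j + 1)) = K := by
        rw [hlam, mul_left_comm, ← mul_pow]; norm_num
      set θ : ℝ := min 1 (lam ^ p * Y j) with hθ
      have hθ0 : 0 < θ := lt_min one_pos (by positivity)
      have hvol : volume {x | x ∈ Metric.ball x₀ (ρ j) ∧ k j + K * (1 / 2) ^ (j + 1) < u x} ≤
          ENNReal.ofReal (θ * V) := by
        rcases le_total 1 (lam ^ p * Y j) with h | h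
        · rw [hθ, min_eq_left h, one_mul]
          refine (measure_mono fun x hx => Metric.ball_subset_ball (hρup j) hx.1).trans
            (le_of_eq ?_)
          have : Nontrivial (Eucl N) := by
            apply Module.nontrivial_of_finrank_pos (R := ℝ)
            simpa using hN
          rw [Measure.addHaar_ball volume x₀ hr.le, finrank_euclideanSpace_fin,
            ← ENNReal.ofReal_toReal (measure_ball_lt_top (μ := volume) (x := (0 : Eucl N))).ne,
            ← hω, ← ENNReal.ofReal_mul (by positivity), hV, mul_comm]
        · rw [hθ, min_eq_right h]
          have := measure_superlevel_le (s₁ := s₁) (sp := sp) (k := k j) hp hr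
            (by positivity : 0 < K * (1 / 2) ^ (j + 1)) hlam1 hV0 hu
            (Metric.isOpen_ball (x := x₀) (ε := ρ j)).measurableSet (hyfin j)
          rwa [hlamK] at this
      have hst := hstep Ω u hu hsol x₀ r T M hr hT0 hM hBΩ hT (k j) (K * (1 / 2) ^ (j + 1)) lam
        (ρ (j + 1)) (ρ j) θ (hk0 j) (by positivity) hlam1 (by rwa [hlamK]) (hρlow _) (hρlt j)
        (hρup j) hθ0 (min_le_left _ _) hvol
      rw [← hkj j] at hst
      change y (j + 1) ≤ _ * y j at hst
      have hΛ : 1 + r * (2 / (ρ j - ρ (j + 1))) ≤ 9 * 2 ^ j := by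
        rw [hρj j]
        have e : r * (2 / (r / 2 * (1 / 2) ^ (j + 1))) = 8 * 2 ^ j := by
          rw [one_div, inv_pow, pow_succ]; field_simp; norm_num
        rw [e]
        have : (1 : ℝ) ≤ 2 ^ j := one_le_pow₀ (by norm_num)
        linarith
      have hΛ0 : 0 ≤ 1 + r * (2 / (ρ j - ρ (j + 1))) := by
        rw [hρj j]; positivity
      have hcoef : C * (1 + M) * (1 + r * (2 / (ρ j - ρ (j + 1)))) ^ ((N : ℝ) + p) * lam ^ p *
          θ ^ ε ≤ A * b ^ j * Y j ^ ε := by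
        have e1 : (1 + r * (2 / (ρ j - ρ (j + 1)))) ^ ((N : ℝ) + p) ≤
            9 ^ ((N : ℝ) + p) * (2 ^ ((N : ℝ) + p)) ^ j := by
          refine (Real.rpow_le_rpow hΛ0 hΛ (by positivity)).trans (le_of_eq ?_)
          rw [Real.mul_rpow (by norm_num) (by positivity), Real.rpow_pow_comm (by norm_num)]
        have e2 : lam ^ p = 2 ^ p * (2 ^ p) ^ j := by
          rw [hlam, ← Real.rpow_pow_comm (by norm_num), pow_succ, mul_comm]
        have e3 : θ ^ ε ≤ (2 ^ p) ^ ε * ((2 ^ p) ^ ε) ^ j * Y j ^ ε := by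
          refine (Real.rpow_le_rpow hθ0.le (min_le_right _ _) hε0.le).trans (le_of_eq ?_)
          rw [Real.mul_rpow (by positivity) (hY0 j), e2, Real.mul_rpow (by positivity)
            (by positivity), Real.rpow_pow_comm (x := (2 : ℝ) ^ p) (by positivity) ε j]
        have hYε : 0 ≤ Y j ^ ε := Real.rpow_nonneg (hY0 j) _
        calc _ ≤ C * (1 + M) * (9 ^ ((N : ℝ) + p) * (2 ^ ((N : ℝ) + p)) ^ j) *
              (2 ^ p * (2 ^ p) ^ j) * ((2 ^ p) ^ ε * ((2 ^ p) ^ ε) ^ j * Y j ^ ε) := by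
              rw [e2]; gcongr
          _ = _ := by
              rw [hA, hb, mul_pow, mul_pow]; ring
      have hreal : (y (j + 1)).toReal ≤ A * b ^ j * Y j ^ ε * (y j).toReal := by
        have h1 := ENNReal.toReal_mono (ENNReal.mul_ne_top ENNReal.ofReal_ne_top (hyfin j)) hst
        rw [ENNReal.toReal_mul, ENNReal.toReal_ofReal (by positivity)] at h1
        exact h1.trans (mul_le_mul_of_nonneg_right hcoef ENNReal.toReal_nonneg)
      simp only [hY]
      rw [← mul_div_assoc]
      exact div_le_div_of_nonneg_right hreal hVH.le
  have hlim := hfast Y hY0 hrec (by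
    have h1 := ENNReal.toReal_mono ENNReal.ofReal_ne_top hy0
    rw [ENNReal.toReal_ofReal (by positivity)] at h1
    simp only [hY]
    rw [div_le_iff₀ hVH]
    linarith)
  have hzero : ∫⁻ x in Metric.ball x₀ (r / 2),
      ENNReal.ofReal (bigH p s₁ sp r (max (u x - K) 0)) = 0 := by
    -- The level `K` lies above every `k j` and the half ball inside every ball, so the limiting
    -- integral is below every `y j`.
    have hle : ∀ j, ∫⁻ x in Metric.ball x₀ (r / 2),
        ENNReal.ofReal (bigH p s₁ sp r (max (u x - K) 0)) ≤
          ENNReal.ofReal (V * bigH p s₁ sp r K * Y j) := by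
      intro j
      have e : V * bigH p s₁ sp r K * Y j = (y j).toReal := by
        simp only [hY]; field_simp
      rw [e, ENNReal.ofReal_toReal (hyfin j)]
      refine (lintegral_mono_set (Metric.ball_subset_ball (hρlow j))).trans ?_
      refine lintegral_mono fun x => ENNReal.ofReal_le_ofReal ?_
      exact bigH_mono hp hr (le_max_right _ _) (max_le_max (by linarith [hkK j]) le_rfl)
    have hlim' : Filter.Tendsto (fun j => ENNReal.ofReal (V * bigH p s₁ sp r K * Y j))
        Filter.atTop (nhds 0) := by
      have := ENNReal.tendsto_ofReal (hlim.const_mul (V * bigH p s₁ sp r K))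
      simpa using this
    exact le_antisymm (ge_of_tendsto' hlim' hle) zero_le
  rw [lintegral_eq_zero_iff (by fun_prop)] at hzero
  filter_upwards [hzero] with x hx
  by_contra hlt
  have h1 : 0 < max (u x - K) 0 := lt_max_of_lt_left (by linarith [not_le.1 hlt])
  have h2 := bigH_pos (p := p) (s₁ := s₁) (sp := sp) hr h1
  exact absurd hx (by simpa using h2)

end Iteration

/-! ### Change of representative and the symmetry `u ↦ -u` -/

section Congr

variable {N : ℕ} {p s₁ sp : ℝ}

theorem ae_fst_snd_eq {u v : Eucl N → ℝ} (h : u =ᵐ[volume] v) :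
    ∀ᵐ z : Eucl N × Eucl N, u z.1 = v z.1 ∧ u z.2 = v z.2 := by
  rw [Measure.volume_eq_prod]
  filter_upwards [Measure.quasiMeasurePreserving_fst.ae h,
    Measure.quasiMeasurePreserving_snd.ae h] with z h1 h2
  exact ⟨h1, h2⟩

theorem MemFracSobolev.congr_ae {γ q : ℝ} {S : Set (Eucl N)} {u v : Eucl N → ℝ}
    (h : u =ᵐ[volume] v) (hu : MemFracSobolev γ q S u) : MemFracSobolev γ q S v := by
  refine ⟨(memLp_congr_ae (ae_restrict_of_ae h)).1 hu.1, ?_⟩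
  refine lt_of_eq_of_lt (lintegral_congr_ae (ae_restrict_of_ae ?_)) hu.2
  filter_upwards [ae_fst_snd_eq h] with z hz
  rw [hz.1, hz.2]

theorem IsWeakSolution.congr_ae {Ω : Set (Eucl N)} {u v : Eucl N → ℝ} (h : u =ᵐ[volume] v)
    (hu : IsWeakSolution p s₁ sp Ω u) : IsWeakSolution p s₁ sp Ω v := by
  obtain ⟨h1, hp, ⟨ht1, ht2, ht3⟩, Z, hZ, hZs, heq⟩ := hu
  refine ⟨fun U hU hUc hUΩ => (h1 U hU hUc hUΩ).congr_ae h,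
    fun U hU hUc hUΩ => (hp U hU hUc hUΩ).congr_ae h, ⟨ht1.congr h, ?_, ?_⟩, Z, hZ, ?_, ?_⟩
  · exact ht2.congr (h.mono fun x hx => by simp only [hx])
  · exact ht3.congr (h.mono fun x hx => by simp only [hx])
  · filter_upwards [hZs, ae_fst_snd_eq h] with z hz hz'
    rwa [← hz'.1, ← hz'.2]
  · intro φ hφ1 hφp hφc hφΩ
    rw [← heq φ hφ1 hφp hφc hφΩ]
    congr 1
    refine integral_congr_ae ?_
    filter_upwards [ae_fst_snd_eq h] with z hz
    rw [hz.1, hz.2]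

theorem MemFracSobolev.neg {γ q : ℝ} {S : Set (Eucl N)} {u : Eucl N → ℝ}
    (hu : MemFracSobolev γ q S u) : MemFracSobolev γ q S (fun x => -u x) := by
  refine ⟨hu.1.neg, lt_of_eq_of_lt ?_ hu.2⟩
  simp only [gagliardo, neg_sub_neg, abs_sub_comm]

/-- The pair `(-u, -Z)` solves the same equation because both operators are odd; bounds for `u_-`
are thus bounds for `u_+`. -/
theorem IsWeakSolution.neg {Ω : Set (Eucl N)} {u : Eucl N → ℝ}
    (hu : IsWeakSolution p s₁ sp Ω u) : IsWeakSolution p s₁ sp Ω (fun x => -u x) := by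
  obtain ⟨h1, hp, ⟨ht1, ht2, ht3⟩, Z, hZ, hZs, heq⟩ := hu
  refine ⟨fun U hU hUc hUΩ => (h1 U hU hUc hUΩ).neg, fun U hU hUc hUΩ => (hp U hU hUc hUΩ).neg,
    ⟨ht1.neg, by simpa only [abs_neg] using ht2, by simpa only [abs_neg] using ht3⟩,
    fun z => -Z z, hZ.neg, ?_, ?_⟩
  · filter_upwards [hZs] with z hz
    have := neg_mem_sgnSet hz
    rwa [neg_sub'] at this
  · intro φ hφ1 hφp hφc hφΩ
    have h := heq φ hφ1 hφp hφc hφΩ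
    rw [← neg_eq_zero, neg_add, ← integral_neg, ← integral_neg] at h
    rw [← h]
    congr 1
    · refine integral_congr_ae (Filter.Eventually.of_forall fun z => ?_)
      simp only
      ring
    · refine integral_congr_ae (Filter.Eventually.of_forall fun z => ?_)
      have e : -u z.1 - -u z.2 = -(u z.1 - u z.2) := by ring
      simp only [e, abs_neg]
      ring

theorem Tail_neg (u : Eucl N → ℝ) (x₀ : Eucl N) (R : ℝ) :
    Tail p sp (fun x => -u x) x₀ R = Tail p sp u x₀ R := by
  simp [Tail]

theorem Tail_congr_ae {u v : Eucl N → ℝ} (h : u =ᵐ[volume] v) (x₀ : Eucl N) (R : ℝ) :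
    Tail p sp u x₀ R = Tail p sp v x₀ R := by
  unfold Tail
  congr 2
  exact integral_congr_ae (ae_restrict_of_ae (h.mono fun x hx => by simp only [hx]))

end Congr

/-! ### Finiteness of the tail -/

section Tail

variable {N : ℕ} {p sp : ℝ} {u : Eucl N → ℝ}

/-- Off the ball, `1 + ‖x‖` is at most a constant times `‖x - x₀‖`. Hence the Bochner integral in
`Tail` is a genuine one and not the default value 0. -/
theorem MemTailSpace.integrableOn_compl_ball (hp : 1 < p) (hsp : 0 < sp) (hu : Measurable u)
    (h : MemTailSpace (p - 1) (sp * p) u) (x₀ : Eucl N) {R : ℝ} (hR : 0 < R) :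
    IntegrableOn (fun x => |u x| ^ (p - 1) / ‖x - x₀‖ ^ ((N : ℝ) + sp * p))
      (Metric.ball x₀ R)ᶜ volume := by
  set a : ℝ := (N : ℝ) + sp * p with ha
  have ha0 : 0 ≤ a := by positivity
  set c : ℝ := (1 + ‖x₀‖) / R + 1 with hc
  have hc0 : 0 < c := by positivity
  refine ((h.2.2.const_mul (c ^ a)).integrableOn (s := (Metric.ball x₀ R)ᶜ)).mono'
    (Measurable.aestronglyMeasurable (by fun_prop)) ?_
  refine (ae_restrict_iff' Metric.isOpen_ball.measurableSet.compl).2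
    (Filter.Eventually.of_forall fun x hx => ?_)
  have h1 : R ≤ ‖x - x₀‖ := by simpa [dist_eq_norm] using hx
  have h2 : 1 + ‖x‖ ≤ c * ‖x - x₀‖ := by
    have h3 : ‖x‖ ≤ ‖x - x₀‖ + ‖x₀‖ := by simpa using norm_add_le (x - x₀) x₀
    have h4 : 1 + ‖x₀‖ ≤ (1 + ‖x₀‖) / R * ‖x - x₀‖ := by
      rw [div_mul_eq_mul_div, le_div_iff₀ hR]
      gcongr
    rw [hc, add_mul, one_mul]
    linarith
  have h0 : 0 < ‖x - x₀‖ := by linarith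
  have h5 := Real.rpow_le_rpow (by positivity) h2 ha0
  rw [Real.mul_rpow hc0.le h0.le] at h5
  rw [Real.norm_of_nonneg (by positivity), ← mul_div_assoc,
    div_le_div_iff₀ (by positivity) (by positivity)]
  have := mul_le_mul_of_nonneg_left h5 (by positivity : 0 ≤ |u x| ^ (p - 1))
  linarith

theorem Tail_rpow (hp : 1 < p) (x₀ : Eucl N) {R : ℝ} (hR : 0 < R) :
    Tail p sp u x₀ R ^ (p - 1) = R ^ (sp * p) * ∫ x in (Metric.ball x₀ R)ᶜ,
      |u x| ^ (p - 1) / ‖x - x₀‖ ^ ((N : ℝ) + sp * p) := by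
  have h0 : 0 ≤ ∫ x in (Metric.ball x₀ R)ᶜ, |u x| ^ (p - 1) / ‖x - x₀‖ ^ ((N : ℝ) + sp * p) :=
    integral_nonneg fun x => by positivity
  rw [Tail, ← Real.rpow_mul (by positivity), one_div_mul_cancel (by linarith), Real.rpow_one]

end Tail

/-! ### Generalised inverses -/

section Inverse

variable {p s₁ sp r : ℝ}

theorem incrInv_nonneg (f : ℝ → ℝ) (y : ℝ) : 0 ≤ incrInv f y :=
  Real.sInf_nonneg fun _ ht => ht.1

/-- Approximation from above replaces continuity and attainment of the infimum. Nonemptiness is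
needed because `sInf ∅ = 0`. -/
theorem exists_lt_of_incrInv_lt {f : ℝ → ℝ} {y s : ℝ} (hne : ∃ t, 0 ≤ t ∧ y ≤ f t)
    (h : incrInv f y < s) : ∃ t, 0 ≤ t ∧ y ≤ f t ∧ t < s := by
  obtain ⟨t, ht, hts⟩ := exists_lt_of_csInf_lt (s := {t : ℝ | 0 ≤ t ∧ y ≤ f t}) hne h
  exact ⟨t, ht.1, ht.2, hts⟩

theorem exists_le_bigH (hr : 0 < r) (y : ℝ) : ∃ t, 0 ≤ t ∧ y ≤ bigH p s₁ sp r t := by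
  have hr1 : 0 < r ^ s₁ := by positivity
  refine ⟨|y| * r ^ s₁, by positivity, ?_⟩
  rw [bigH, mul_div_cancel_right₀ _ hr1.ne']
  have h1 : 0 ≤ (|y| * r ^ s₁) ^ p / r ^ (sp * p) := by positivity
  linarith [le_abs_self y]

theorem exists_le_smallH (hp : 1 < p) (hr : 0 < r) (y : ℝ) :
    ∃ t, 0 ≤ t ∧ y ≤ smallH p s₁ sp r t := by
  have hr1 : 0 < r ^ (sp * p) := by positivity
  refine ⟨(|y| * r ^ (sp * p)) ^ (1 / (p - 1)), by positivity, ?_⟩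
  rw [smallH, ← Real.rpow_mul (by positivity), one_div_mul_cancel (by linarith), Real.rpow_one,
    mul_div_cancel_right₀ _ hr1.ne']
  have h1 : 0 ≤ 1 / r ^ s₁ := by positivity
  linarith [le_abs_self y]

end Inverse

/-! ### The sup estimate and local boundedness -/

section Main

variable {N : ℕ} {p s₁ sp : ℝ}

theorem IsWeakSolution.integrableOn_bigH (hp : 1 < p) {Ω : Set (Eucl N)} {u : Eucl N → ℝ}
    (hu : Measurable u) (hsol : IsWeakSolution p s₁ sp Ω u) {x₀ : Eucl N} {r : ℝ} (hr : 0 < r)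
    (hB : closure (Metric.ball x₀ r) ⊆ Ω) :
    IntegrableOn (fun x => bigH p s₁ sp r (max (u x) 0)) (Metric.ball x₀ r) volume := by
  have hc := (Metric.isBounded_ball (x := x₀) (r := r)).isCompact_closure
  have h1 := (hsol.1 _ Metric.isOpen_ball hc hB).lintegral_rpow_lt_top one_pos
  have hp' := (hsol.2.1 _ Metric.isOpen_ball hc hB).lintegral_rpow_lt_top (by linarith)
  have i1 : Integrable (fun x => |u x| ^ (1 : ℝ)) (volume.restrict (Metric.ball x₀ r)) :=
    integrable_of_lintegral_ofReal_lt_top (by fun_prop) (fun x => by positivity) h1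
  have ip : Integrable (fun x => |u x| ^ p) (volume.restrict (Metric.ball x₀ r)) :=
    integrable_of_lintegral_ofReal_lt_top (by fun_prop) (fun x => by positivity) hp'
  refine ((i1.div_const (r ^ s₁)).add (ip.div_const (r ^ (sp * p)))).mono'
    (Measurable.aestronglyMeasurable (by fun_prop)) (Filter.Eventually.of_forall fun x => ?_)
  rw [Real.norm_of_nonneg (bigH_nonneg hr (le_max_right _ _))]
  have h : bigH p s₁ sp r (max (u x) 0) ≤ bigH p s₁ sp r |u x| :=
    bigH_mono hp hr (le_max_right _ _) (max_le (le_abs_self _) (abs_nonneg _))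
  simpa [bigH] using h

/-- The local sup estimate for the positive part of a measurable weak solution. -/
theorem exists_posPart_le_of_measurable (hN : 0 < N) (hp : 1 < p) (hs₁ : s₁ ∈ Ioo (0 : ℝ) 1)
    (hsp : sp ∈ Ioo (0 : ℝ) 1) {δ : ℝ} (hδ : 0 < δ) : ∃ C : ℝ, 0 < C ∧
    ∀ (Ω : Set (Eucl N)) (u : Eucl N → ℝ), Measurable u → IsWeakSolution p s₁ sp Ω u →
    ∀ (x₀ : Eucl N) (r : ℝ), 0 < r → closure (Metric.ball x₀ r) ⊆ Ω →
      ∀ᵐ x ∂(volume.restrict (Metric.ball x₀ (r / 2))),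
        max (u x) 0 ≤
          C * incrInv (bigH p s₁ sp r)
              (⨍ y in Metric.ball x₀ r, bigH p s₁ sp r (max (u y) 0)) +
            δ * incrInv (smallH p s₁ sp r)
              (r ^ (-(sp * p)) * (Tail p sp u x₀ (r / 2) ^ (p - 1) + 1)) := by
  -- From `δ * s ≤ K` follows `s ≤ c * K`, which costs `c ^ (p - 1)` in `h_r`. The other factor of
  -- `M`, `2 ^ (sp * p)`, comes from the radius `r / 2` in the tail.
  set c : ℝ := max 1 δ⁻¹ with hc
  have hc1 : 1 ≤ c := le_max_left _ _
  set M : ℝ := 2 ^ (sp * p) * c ^ (p - 1) with hM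
  have hspp : 0 < sp * p := by have := hsp.1; positivity
  obtain ⟨ν, hν, hiter⟩ := exists_ae_le_of_lintegral_bigH_le hN hp hs₁ hsp
    (M := M) (by positivity)
  -- Superlinearity turns this into `ν⁻¹ * H_r(t) ≤ H_r(C * t)`, which is the smallness required by
  -- the iteration.
  set C : ℝ := max 1 ν⁻¹ with hC
  have hC1 : 1 ≤ C := le_max_left _ _
  have hC0 : 0 < C := by linarith
  refine ⟨C, hC0, fun Ω u hu hsol x₀ r hr hB => ?_⟩
  set X := incrInv (bigH p s₁ sp r) (⨍ y in Metric.ball x₀ r, bigH p s₁ sp r (max (u y) 0)) with hX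
  set W := incrInv (smallH p s₁ sp r)
    (r ^ (-(sp * p)) * (Tail p sp u x₀ (r / 2) ^ (p - 1) + 1)) with hW
  have hX0 : 0 ≤ X := incrInv_nonneg _ _
  have hW0 : 0 ≤ W := incrInv_nonneg _ _
  set I : ℝ := ∫ x in (Metric.ball x₀ (r / 2))ᶜ,
    |u x| ^ (p - 1) / ‖x - x₀‖ ^ ((N : ℝ) + sp * p) with hI
  have hI0 : 0 ≤ I := integral_nonneg fun x => by positivity
  have hItail : Tail p sp u x₀ (r / 2) ^ (p - 1) = (r / 2) ^ (sp * p) * I :=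
    Tail_rpow hp x₀ (by positivity)
  have hT : ∫⁻ y in (Metric.ball x₀ (r / 2))ᶜ,
      ENNReal.ofReal (|u y| ^ (p - 1) / ‖y - x₀‖ ^ ((N : ℝ) + sp * p)) ≤ ENNReal.ofReal I := by
    rw [hI, ofReal_integral_eq_lintegral_ofReal
      (hsol.2.2.1.integrableOn_compl_ball hp hsp.1 hu x₀ (by positivity))
      (Filter.Eventually.of_forall fun x => by simp only [Pi.zero_apply]; positivity)]
  -- The slack `η` keeps `K` positive and provides witnesses `t`, `s` just above the two generalised
  -- inverses; it is later sent to 0 along `1 / (n + 1)`.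
  have hbound : ∀ η : ℝ, 0 < η →
      ∀ᵐ x ∂(volume.restrict (Metric.ball x₀ (r / 2))), u x ≤ C * X + δ * W + η := by
    intro η hη
    obtain ⟨t, ht0, htH, htX⟩ := exists_lt_of_incrInv_lt (s := X + η / (2 * C))
      (exists_le_bigH hr _) (by rw [← hX]; have : 0 < η / (2 * C) := by positivity
                                linarith)
    obtain ⟨s, hs0, hsH, hsW⟩ := exists_lt_of_incrInv_lt (s := W + η / (2 * δ))
      (exists_le_smallH hp hr _) (by rw [← hW]; have : 0 < η / (2 * δ) := by positivity
                                     linarith)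
    have hCt : C * t + δ * s ≤ C * X + δ * W + η := by
      have h1 : C * t ≤ C * (X + η / (2 * C)) := by gcongr
      have h2 : δ * s ≤ δ * (W + η / (2 * δ)) := by gcongr
      have h3 : C * (η / (2 * C)) = η / 2 := by field_simp
      have h4 : δ * (η / (2 * δ)) = η / 2 := by field_simp
      linarith
    set K : ℝ := C * X + δ * W + η with hK
    have hK0 : 0 < K := by positivity
    refine hiter Ω u hu hsol x₀ r I K hr hI0 hK0 hB hT ?_ ?_
    · have h1 : I ≤ 2 ^ (sp * p) * smallH p s₁ sp r s := by
        refine le_trans ?_ (mul_le_mul_of_nonneg_left hsH (by positivity))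
        rw [hItail, Real.div_rpow hr.le (by norm_num), Real.rpow_neg hr.le]
        have h2 : 0 < r ^ (sp * p) := by positivity
        have h3 : (0 : ℝ) < 2 ^ (sp * p) := by positivity
        have e : 2 ^ (sp * p) * ((r ^ (sp * p))⁻¹ * (r ^ (sp * p) / 2 ^ (sp * p) * I + 1)) =
          I + 2 ^ (sp * p) * (r ^ (sp * p))⁻¹ := by field_simp
        rw [e]
        have : 0 ≤ 2 ^ (sp * p) * (r ^ (sp * p))⁻¹ := by positivity
        linarith
      have h2 : s ≤ c * K := by
        have h3 : δ * s ≤ K := by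
          have : 0 ≤ C * t := by positivity
          linarith
        have h4 : δ⁻¹ * (δ * s) ≤ c * K := by
          refine mul_le_mul (le_max_right _ _) h3 (by positivity) (by positivity)
        rwa [inv_mul_cancel_left₀ hδ.ne'] at h4
      have h3 := (smallH_mono (s₁ := s₁) (sp := sp) hp hr hs0 h2).trans
        (smallH_mul_le hp hr hc1 hK0.le)
      refine h1.trans ?_
      rw [hM, mul_assoc]
      gcongr
    · have hint := hsol.integrableOn_bigH hp hu hr hB
      have hvol : (volume (Metric.ball x₀ r)).toReal =
          (volume (Metric.ball (0 : Eucl N) 1)).toReal * r ^ N := by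
        have : Nontrivial (Eucl N) := by
          apply Module.nontrivial_of_finrank_pos (R := ℝ)
          simpa using hN
        rw [Measure.addHaar_ball volume x₀ hr.le, finrank_euclideanSpace_fin, ENNReal.toReal_mul,
          ENNReal.toReal_ofReal (by positivity), mul_comm]
      rw [← ofReal_integral_eq_lintegral_ofReal hint
        (Filter.Eventually.of_forall fun x => bigH_nonneg hr (le_max_right _ _)), ← hvol]
      refine ENNReal.ofReal_le_ofReal ?_
      have hvpos : 0 < (volume (Metric.ball x₀ r)).toReal :=
        ENNReal.toReal_pos (Metric.measure_ball_pos _ _ hr).ne' measure_ball_lt_top.ne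
      rw [setAverage_eq, smul_eq_mul, Measure.real] at htH
      have h1 : ν⁻¹ * bigH p s₁ sp r t ≤ bigH p s₁ sp r K := by
        have hCtK : C * t ≤ K := by
          have : 0 ≤ δ * s := by positivity
          linarith
        refine le_trans ?_ (bigH_mono hp hr (by positivity) hCtK)
        refine le_trans ?_ (mul_bigH_le hp hr hC1 ht0)
        exact mul_le_mul_of_nonneg_right (le_max_right _ _) (bigH_nonneg hr ht0)
      rw [inv_mul_le_iff₀ hν] at h1
      rw [inv_mul_le_iff₀ hvpos] at htH
      refine htH.trans ?_
      rw [mul_comm]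
      gcongr
  have hall : ∀ᵐ x ∂(volume.restrict (Metric.ball x₀ (r / 2))),
      ∀ n : ℕ, u x ≤ C * X + δ * W + 1 / ((n : ℝ) + 1) :=
    ae_all_iff.2 fun n => hbound _ (by positivity)
  filter_upwards [hall] with x hx
  refine max_le ?_ (by positivity)
  refine ge_of_tendsto' (x := Filter.atTop) ?_ hx
  simpa using (tendsto_one_div_add_atTop_nhds_zero_nat (𝕜 := ℝ)).const_add (C * X + δ * W)

theorem exists_posPart_le (hN : 0 < N) (hp : 1 < p) (hs₁ : s₁ ∈ Ioo (0 : ℝ) 1)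
    (hsp : sp ∈ Ioo (0 : ℝ) 1) {δ : ℝ} (hδ : 0 < δ) : ∃ C : ℝ, 0 < C ∧
    ∀ (Ω : Set (Eucl N)) (u : Eucl N → ℝ), IsWeakSolution p s₁ sp Ω u →
    ∀ (x₀ : Eucl N) (r : ℝ), 0 < r → closure (Metric.ball x₀ r) ⊆ Ω →
      ∀ᵐ x ∂(volume.restrict (Metric.ball x₀ (r / 2))),
        max (u x) 0 ≤
          C * incrInv (bigH p s₁ sp r)
              (⨍ y in Metric.ball x₀ r, bigH p s₁ sp r (max (u y) 0)) +
            δ * incrInv (smallH p s₁ sp r)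
              (r ^ (-(sp * p)) * (Tail p sp u x₀ (r / 2) ^ (p - 1) + 1)) := by
  obtain ⟨C, hC, h⟩ := exists_posPart_le_of_measurable hN hp hs₁ hsp hδ
  refine ⟨C, hC, fun Ω u hu x₀ r hr hB => ?_⟩
  have hae := hu.2.2.1.1
  have heq := hae.ae_eq_mk
  have h1 := h Ω _ hae.stronglyMeasurable_mk.measurable (hu.congr_ae heq) x₀ r hr hB
  rw [← Tail_congr_ae heq] at h1
  have h2 : (⨍ y in Metric.ball x₀ r, bigH p s₁ sp r (max (hae.mk u y) 0)) =
      ⨍ y in Metric.ball x₀ r, bigH p s₁ sp r (max (u y) 0) := by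
    rw [setAverage_eq, setAverage_eq]
    congr 1
    exact integral_congr_ae (ae_restrict_of_ae (heq.mono fun x hx => by simp only [hx]))
  rw [h2] at h1
  filter_upwards [h1, ae_restrict_of_ae heq] with x hx hx'
  rwa [hx']

theorem exists_posPart_negPart_le (hN : 0 < N) (hp : 1 < p) (hs₁ : s₁ ∈ Ioo (0 : ℝ) 1)
    (hsp : sp ∈ Ioo (0 : ℝ) 1) {δ : ℝ} (hδ : 0 < δ) : ∃ C : ℝ, 0 < C ∧
    ∀ (Ω : Set (Eucl N)) (u : Eucl N → ℝ), IsWeakSolution p s₁ sp Ω u →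
    ∀ (x₀ : Eucl N) (r : ℝ), 0 < r → closure (Metric.ball x₀ r) ⊆ Ω →
      (∀ᵐ x ∂(volume.restrict (Metric.ball x₀ (r / 2))),
        max (u x) 0 ≤
          C * incrInv (bigH p s₁ sp r)
              (⨍ y in Metric.ball x₀ r, bigH p s₁ sp r (max (u y) 0)) +
            δ * incrInv (smallH p s₁ sp r)
              (r ^ (-(sp * p)) * (Tail p sp u x₀ (r / 2) ^ (p - 1) + 1))) ∧
      (∀ᵐ x ∂(volume.restrict (Metric.ball x₀ (r / 2))),
        max (-u x) 0 ≤
          C * incrInv (bigH p s₁ sp r)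
              (⨍ y in Metric.ball x₀ r, bigH p s₁ sp r (max (-u y) 0)) +
            δ * incrInv (smallH p s₁ sp r)
              (r ^ (-(sp * p)) * (Tail p sp u x₀ (r / 2) ^ (p - 1) + 1))) := by
  obtain ⟨C, hC, h⟩ := exists_posPart_le hN hp hs₁ hsp hδ
  refine ⟨C, hC, fun Ω u hu x₀ r hr hB => ⟨h Ω u hu x₀ r hr hB, ?_⟩⟩
  have := h Ω _ hu.neg x₀ r hr hB
  rwa [Tail_neg] at this

/-- Each point of the compact set has a half ball on which the estimate with `δ = 1` bounds both
parts of `u`; essential boundedness passes to finite unions. -/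
theorem IsWeakSolution.isLocallyBoundedIn (hN : 0 < N) (hp : 1 < p) (hs₁ : s₁ ∈ Ioo (0 : ℝ) 1)
    (hsp : sp ∈ Ioo (0 : ℝ) 1) {Ω : Set (Eucl N)} (hΩ : IsOpen Ω) {u : Eucl N → ℝ}
    (hu : IsWeakSolution p s₁ sp Ω u) : IsLocallyBoundedIn Ω u := by
  obtain ⟨C, -, h⟩ := exists_posPart_negPart_le hN hp hs₁ hsp one_pos
  intro K hK hKΩ
  refine hK.induction_on (p := fun S => ∃ M : ℝ, ∀ᵐ x ∂(volume.restrict S), |u x| ≤ M) ?_ ?_ ?_ ?_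
  · exact ⟨0, by simp⟩
  · rintro S S' hS ⟨M, hM⟩
    exact ⟨M, ae_restrict_of_ae_restrict_of_subset hS hM⟩
  · rintro S S' ⟨M, hM⟩ ⟨M', hM'⟩
    refine ⟨max M M', ?_⟩
    rw [ae_restrict_union_iff]
    exact ⟨hM.mono fun x hx => hx.trans (le_max_left _ _),
      hM'.mono fun x hx => hx.trans (le_max_right _ _)⟩
  · intro x₀ hx₀
    obtain ⟨r, hr, hrΩ⟩ := Metric.nhds_basis_closedBall.mem_iff.1 (hΩ.mem_nhds (hKΩ hx₀))
    refine ⟨Metric.ball x₀ (r / 2),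
      mem_nhdsWithin_of_mem_nhds (Metric.ball_mem_nhds _ (by positivity)), ?_⟩
    have hr2 := h Ω u hu x₀ r hr (Metric.closure_ball_subset_closedBall.trans hrΩ)
    obtain ⟨A, hA⟩ : ∃ A : ℝ, ∀ᵐ x ∂(volume.restrict (Metric.ball x₀ (r / 2))),
        max (u x) 0 ≤ A := ⟨_, hr2.1⟩
    obtain ⟨A', hA'⟩ : ∃ A : ℝ, ∀ᵐ x ∂(volume.restrict (Metric.ball x₀ (r / 2))),
        max (-u x) 0 ≤ A := ⟨_, hr2.2⟩
    refine ⟨max A A', ?_⟩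
    filter_upwards [hA, hA'] with x hx1 hx2
    exact abs_le'.2 ⟨(le_max_left _ _).trans (hx1.trans (le_max_left _ _)),
      (le_max_left _ _).trans (hx2.trans (le_max_right _ _))⟩

end Main

theorem proposition3p3 (N : ℕ) (hN : 2 ≤ N) (p s₁ sp : ℝ) (hp : 1 < p)
    (hs₁ : s₁ ∈ Set.Ioo (0 : ℝ) 1) (hsp : sp ∈ Set.Ioo (0 : ℝ) 1) :
    (∀ Ω : Set (Eucl N), IsOpen Ω → IsConnected Ω → Bornology.IsBounded Ω →
      ∀ u : Eucl N → ℝ, IsWeakSolution p s₁ sp Ω u → IsLocallyBoundedIn Ω u) ∧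
    ∀ δ : ℝ, 0 < δ → ∃ C : ℝ, 0 < C ∧
      ∀ Ω : Set (Eucl N), IsOpen Ω → IsConnected Ω → Bornology.IsBounded Ω →
      ∀ u : Eucl N → ℝ, IsWeakSolution p s₁ sp Ω u →
      ∀ (x₀ : Eucl N) (r : ℝ), 0 < r → closure (Metric.ball x₀ (2 * r)) ⊆ Ω →
        (∀ᵐ x ∂(volume.restrict (Metric.ball x₀ (r / 2))),
          max (u x) 0 ≤
            C * incrInv (bigH p s₁ sp r)
                (⨍ y in Metric.ball x₀ r, bigH p s₁ sp r (max (u y) 0)) +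
              δ * incrInv (smallH p s₁ sp r)
                (r ^ (-(sp * p)) * (Tail p sp u x₀ (r / 2) ^ (p - 1) + 1))) ∧
        (∀ᵐ x ∂(volume.restrict (Metric.ball x₀ (r / 2))),
          max (-u x) 0 ≤
            C * incrInv (bigH p s₁ sp r)
                (⨍ y in Metric.ball x₀ r, bigH p s₁ sp r (max (-u y) 0)) +
              δ * incrInv (smallH p s₁ sp r)
                (r ^ (-(sp * p)) * (Tail p sp u x₀ (r / 2) ^ (p - 1) + 1))) := by
  have hN0 : 0 < N := by omega
  refine ⟨fun Ω hΩ _ _ u hu => hu.isLocallyBoundedIn hN0 hp hs₁ hsp hΩ, fun δ hδ => ?_⟩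
  obtain ⟨C, hC, h⟩ := exists_posPart_negPart_le hN0 hp hs₁ hsp hδ
  refine ⟨C, hC, fun Ω _ _ _ u hu x₀ r hr hB => h Ω u hu x₀ r hr ?_⟩
  exact (closure_mono (Metric.ball_subset_ball (by linarith))).trans hB
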